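/- Notation. For a meromorphic function $g$ on $\mathbb{C}$ let $m(r,g)=\frac1{2\pi}\int_0^{2\pi}\log^+|g(re^{i\theta})|\,d\theta$ be the proximity function, $N(r,g)$ the integrated counting function of the poles of $g$ (with multiplicity), and $T(r,g)=m(r,g)+N(r,g)$ the Nevanlinna characteristic. A measurable set $E\subset(0,\infty)$ has finite logarithmic measure if $\int_E dt/t<\infty$. For a real function $h$ of $r$ we write $h(r)=S(r,f)$ if there is a set $E$ of finite logarithmic measure with $h(r)=o(T(r,f))$ as $r\to\infty$, $r\notin E$. Theorem 1.3. Let $f$ be a non-constant meromorphic function on $\mathbb{C}$, and let $\omega(r)>0$ for $r>0$. For $\varepsilon>0$ consider the condition $$\omega(r)\le \frac{1}{T(r+\varepsilon,f)^{\frac{3\varepsilon}{1+2\varepsilon}}}\cdot\frac{1}{r^{\frac{\varepsilon}{1+\varepsilon}}}\qquad\text{for all sufficiently large } r, \tag{$*_\varepsilon$}$$ where "sufficiently large" may depend on $\varepsilon$. (i) If $(*_\varepsilon)$ holds for every $\varepsilon>0$, then $$m\left(r,\frac{f(e^{i\omega(r)}z)-f(z)}{f'(z)}\right)=S(r,f).$$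 (ii) If $f$ is transcendental (that is, not a rational function), then the same conclusion holds as soon as $(*_\varepsilon)$ holds for at least one $\varepsilon>0$. Here, for each fixed $r$, the proximity function is that of the meromorphic function $z\mapsto (f(e^{i\omega(r)}z)-f(z))/f'(z)$, with the number $\omega(r)$ held constant. -/

import Mathlib

open ValueDistribution Filter Topology MeasureTheory

noncomputable section

/-- Exceptional sets: (measurable) sets `E ⊆ (0, ∞)` of finite logarithmic measure,
`∫_E dt / t < ∞`. -/
def FiniteLogMeasure (E : Set ℝ) : Prop :=
  MeasurableSet E ∧ E ⊆ Set.Ioi 0 ∧ ∫⁻ t in E, ENNReal.ofReal (1 / t) < ⊤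

/-- `h(r) = S(r, f)`: `h(r) = o(T(r, f))` as `r → ∞` outside an exceptional set of finite
logarithmic measure. Here `characteristic f ⊤` is the Nevanlinna characteristic `T(·, f)`. -/
def IsSmallError (h : ℝ → ℝ) (f : ℂ → ℂ) : Prop :=
  ∃ E : Set ℝ, FiniteLogMeasure E ∧ h =o[atTop ⊓ 𝓟 Eᶜ] characteristic f ⊤

/-- `f` is constant as a meromorphic function, i.e. up to the values on a discrete set
(a function that is `Meromorphic` in the sense of Mathlib has arbitrary values at such points). -/
def IsConstantMero (f : ℂ → ℂ) : Prop :=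
  ∃ c : ℂ, f =ᶠ[codiscrete ℂ] fun _ => c

/-- `f` is a rational function, up to the values on a discrete set. -/
def IsRationalMero (f : ℂ → ℂ) : Prop :=
  ∃ p q : Polynomial ℂ, q ≠ 0 ∧ f =ᶠ[codiscrete ℂ] fun z => p.eval z / q.eval z

/-- The upper bound `T(r+ε, f)^{-3ε/(1+2ε)} r^{-ε/(1+ε)}` for the angular shift. -/
def shiftBound (f : ℂ → ℂ) (ε r : ℝ) : ℝ :=
  1 / characteristic f ⊤ (r + ε) ^ (3 * ε / (1 + 2 * ε)) * (1 / r ^ (ε / (1 + ε)))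

/-- The quotient `z ↦ (f(e^{iω} z) - f(z)) / f'(z)`. -/
def angularQuotient (f : ℂ → ℂ) (ω : ℝ) : ℂ → ℂ :=
  fun z => (f (Complex.exp (Complex.I * (ω : ℂ)) * z) - f z) / deriv f z

end

/-! ### Poisson's formula and mean values of logarithms on circles. -/

section PoissonEstimates

open Real Metric

/-! Put d = ωr and z' = e^{iω}z, so that |z' - z| ≤ d. If |f'| ≤ |f'(z)| exp Φ on a path of two
segments of length at most d from z to z', the mean value inequality bounds the quotient by 2d exp
Φ. To find Φ, write f' = ∏ (w - u)^{D(u)} · g in a disc of radius R > r, with g free of zeros and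
poles. Poisson's formula controls the variation of log|g| (`abs_log_norm_sub_log_norm_le`). A path
can be chosen whose points are not much closer to any u than z or z' is (`exists_tent`); log|w - u|
then varies by a logarithmic factor times √(d/|z - u|) + √(d/|z' - u|) (`abs_log_sub_log_le_sqrt`).
The square root makes this integrable over |z| = r, with a mean O(√ω) that is uniform in u. The
outcome is `proximity_angularQuotient_le`: log⁺(2ωr), plus terms in T(R, f') and in the number of
zeros and poles of f', multiplied by ω or √ω.

Next take R = r(1 + τ) with τ = T(r, f)^{-δ}/4. Borel's lemma gives T(r(1 + 4τ), f) ≤ 2T(r, f)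
outside a set of finite logarithmic measure, and passing from f to f' and to the counting function
costs only logarithms of r and powers of 1/τ. If ω ≤ T^{-a} r^{-b} and δ = a/10, then √ω ≤ T^{-5δ}
r^{-b/2} pays for these powers, and O(T log² r / r^{b/2}) = o(T) remains.

There is still log⁺(2ωr), the only place where the two cases differ. A transcendental f has log r =
o(T), and ω ≤ 1 eventually. Otherwise only log r ≤ 3T is available, but ωr ≤ r^{1/(1+ε)} for every ε
makes the coefficient of log r arbitrarily small. -/

theorem circleAverage_mono_of_countable {u v : ℂ → ℝ} {r : ℝ} (hr : r ≠ 0) {S : Set ℂ}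
    (hS : S.Countable) (hu : CircleIntegrable u 0 r) (hv : CircleIntegrable v 0 r)
    (h : ∀ z ∈ sphere (0 : ℂ) |r|, z ∉ S → u z ≤ v z) :
    circleAverage u 0 r ≤ circleAverage v 0 r := by
  rw [circleAverage, circleAverage, smul_eq_mul, smul_eq_mul]
  gcongr
  apply intervalIntegral.integral_mono_ae two_pi_pos.le hu hv
  have h0 : volume ((circleMap 0 r) ⁻¹' S) = 0 :=
    (hS.preimage_circleMap 0 hr).measure_zero _
  filter_upwards [measure_eq_zero_iff_ae_notMem.mp h0] with θ hθ
  exact h _ (circleMap_mem_sphere' 0 r θ) hθ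

theorem norm_herglotzRieszKernel_sub_le {R ρ : ℝ} (hρR : ρ < R) {w z ζ : ℂ} (hw : ‖w‖ ≤ ρ)
    (hz : ‖z‖ ≤ ρ) (hζ : ‖ζ‖ = R) :
    ‖herglotzRieszKernel 0 w ζ - herglotzRieszKernel 0 z ζ‖ ≤ 2 * R * ‖w - z‖ / (R - ρ) ^ 2 := by
  have h (x : ℂ) (hx : ‖x‖ ≤ ρ) : R - ρ ≤ ‖ζ - x‖ := by
    have := norm_sub_norm_le ζ x
    linarith
  have h0 (x : ℂ) (hx : ‖x‖ ≤ ρ) : ζ - x ≠ 0 := norm_pos_iff.1 (by linarith [h x hx])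
  have hR : 0 ≤ R := hζ ▸ norm_nonneg ζ
  have e : herglotzRieszKernel 0 w ζ - herglotzRieszKernel 0 z ζ
      = 2 * ζ * (w - z) / ((ζ - w) * (ζ - z)) := by
    have h1 := h0 w hw
    have h2 := h0 z hz
    simp only [herglotzRieszKernel_def, sub_zero]
    field_simp
    ring
  rw [e, norm_div, norm_mul, norm_mul, norm_mul, hζ, Complex.norm_two, sq]
  have hpos : 0 < R - ρ := by linarith
  have h1 := h w hw
  have h2 := h z hz
  gcongr

/-- Since g has no zeros, log|g| is harmonic and equals its Poisson integral. Only the kernel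
depends on the interior point, and it is Lipschitz there. -/
theorem abs_log_norm_sub_log_norm_le {g : ℂ → ℂ} {R ρ : ℝ}
    (hg : AnalyticOnNhd ℂ g (closedBall 0 R)) (hg0 : ∀ z ∈ closedBall (0 : ℂ) R, g z ≠ 0)
    (hρR : ρ < R) {w z : ℂ} (hw : ‖w‖ ≤ ρ) (hz : ‖z‖ ≤ ρ) :
    |log ‖g w‖ - log ‖g z‖| ≤
      2 * R * ‖w - z‖ / (R - ρ) ^ 2 * circleAverage (fun ζ ↦ |log ‖g ζ‖|) 0 R := by
  have hR : 0 < R := by linarith [norm_nonneg w]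
  have hharm : InnerProductSpace.HarmonicOnNhd (fun ζ ↦ log ‖g ζ‖) (closedBall 0 R) :=
    fun x hx ↦ (hg x hx).harmonicAt_log_norm (hg0 x hx)
  have hw' : w ∈ ball (0 : ℂ) R := by simpa using hw.trans_lt hρR
  have hz' : z ∈ ball (0 : ℂ) R := by simpa using hz.trans_lt hρR
  have hcont : ContinuousOn (fun ζ ↦ log ‖g ζ‖) (sphere 0 |R|) := by
    rw [abs_of_pos hR]
    intro x hx
    have hx' := sphere_subset_closedBall hx
    exact ((hg x hx').continuousAt.norm.log
      (norm_ne_zero_iff.2 (hg0 x hx'))).continuousWithinAt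
  have hker (x : ℂ) (hx : x ∈ ball (0 : ℂ) R) :
      ContinuousOn (Complex.re ∘ herglotzRieszKernel 0 x) (sphere 0 |R|) :=
    Complex.continuous_re.comp_continuousOn (continuousOn_herglotzRieszKernel_sphere hx)
  have hci (x : ℂ) (hx : x ∈ ball (0 : ℂ) R) :
      CircleIntegrable ((Complex.re ∘ herglotzRieszKernel 0 x) • fun ζ ↦ log ‖g ζ‖) 0 R :=
    ((hker x hx).smul hcont).circleIntegrable'
  rw [← hharm.circleAverage_re_herglotzRieszKernel_smul hw',
    ← hharm.circleAverage_re_herglotzRieszKernel_smul hz', ← circleAverage_sub (hci w hw')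
      (hci z hz')]
  refine abs_circleAverage_le_circleAverage_abs.trans ?_
  rw [← smul_eq_mul, ← circleAverage_fun_smul]
  apply circleAverage_mono
  · exact ((hci w hw').sub (hci z hz')).abs
  · exact (hcont.abs.circleIntegrable').const_smul
  · intro ζ hζ
    have hζ' : ‖ζ‖ = R := by simpa [abs_of_pos hR] using hζ
    simp only [Pi.abs_apply, Pi.sub_apply, Pi.mul_apply, Function.comp_apply, smul_eq_mul]
    rw [← sub_mul, abs_mul, ← Complex.sub_re]
    gcongr
    exact (Complex.abs_re_le_norm _).trans (norm_herglotzRieszKernel_sub_le hρR hw hz hζ')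

theorem circleIntegrable_log_norm_sub (u : ℂ) (r : ℝ) :
    CircleIntegrable (fun z ↦ log ‖z - u‖) 0 r :=
  MeromorphicOn.circleIntegrable_log_norm (f := fun z ↦ z - u) fun _ _ ↦ by fun_prop

/-- If x ≤ C and C ≥ 0, then |x| ≤ 2C - x. Apply this to x = log|z - u| and C = log 2R; the mean of
x is log r + log⁺(|u|/r) ≥ 0. -/
theorem circleAverage_abs_log_norm_sub_le {r R : ℝ} {u : ℂ} (hr : 1 ≤ r) (hrR : r ≤ R)
    (hu : ‖u‖ ≤ R) : circleAverage (fun z ↦ |log ‖z - u‖|) 0 r ≤ 2 * log (2 * R) := by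
  have hint := circleIntegrable_log_norm_sub u r
  have h1 : circleAverage (fun z ↦ |log ‖z - u‖|) 0 r
      ≤ circleAverage (fun z ↦ 2 * log (2 * R) - log ‖z - u‖) 0 r := by
    apply circleAverage_mono hint.abs ((circleIntegrable_const _ _ _).sub hint)
    intro z hz
    have hz' : ‖z‖ = r := by simpa [abs_of_pos (by linarith : 0 < r)] using hz
    have hle : ‖z - u‖ ≤ 2 * R := (norm_sub_le _ _).trans (by linarith)
    have hR : 0 ≤ log (2 * R) := log_nonneg (by linarith)
    have : log ‖z - u‖ ≤ log (2 * R) := by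
      rcases eq_or_ne ‖z - u‖ 0 with h | h
      · rw [h, log_zero]; exact hR
      · exact log_le_log (by positivity) hle
    simp only [Pi.abs_apply, Pi.sub_apply]
    rw [abs_le]
    constructor <;> linarith
  rw [circleAverage_fun_sub (circleIntegrable_const _ _ _) hint, circleAverage_const,
    circleAverage_log_norm_sub_const_eq_log_radius_add_posLog (by linarith)] at h1
  have := log_nonneg hr
  have := posLog_nonneg (x := r⁻¹ * ‖0 - u‖)
  linarith

end PoissonEstimates

/-! ### Means of |z - a|^{-1/2} over circles, uniformly in a. -/

section SquareRootKernel

open Real Metric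

theorem two_div_pi_mul_min_le_sin {x : ℝ} (h0 : 0 ≤ x) (hπ : x ≤ π) :
    2 / π * min x (π - x) ≤ sin x := by
  rcases le_total x (π / 2) with h | h
  · exact (mul_le_mul_of_nonneg_left (min_le_left _ _) (by positivity)).trans (mul_le_sin h0 h)
  · rw [← sin_pi_sub]
    exact (mul_le_mul_of_nonneg_left (min_le_right _ _) (by positivity)).trans
      (mul_le_sin (by linarith) (by linarith))

theorem inv_sqrt_sin_le {x : ℝ} (h0 : 0 < x) (hπ : x < π) :
    1 / √|sin x| ≤ √(π / 2) * (x ^ (-(1 / 2) : ℝ) + (π - x) ^ (-(1 / 2) : ℝ)) := by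
  have h1 := two_div_pi_mul_min_le_sin h0.le hπ.le
  have hx : 0 < π - x := by linarith
  have hm : 0 < min x (π - x) := lt_min h0 hx
  have h2 : 0 < 2 / π * min x (π - x) := by positivity
  have key : 1 / √|sin x| ≤ √(π / 2) * (min x (π - x)) ^ (-(1 / 2) : ℝ) := by
    rw [rpow_neg hm.le, ← sqrt_eq_rpow, ← div_eq_mul_inv, ← sqrt_div (by positivity), one_div,
      ← sqrt_inv]
    apply sqrt_le_sqrt
    rw [abs_of_pos (h2.trans_le h1)]
    calc (sin x)⁻¹ ≤ (2 / π * min x (π - x))⁻¹ := inv_anti₀ h2 h1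
      _ = _ := by field_simp
  refine key.trans ?_
  gcongr
  have p1 := rpow_nonneg h0.le (-(1 / 2))
  have p2 := rpow_nonneg hx.le (-(1 / 2))
  rcases min_choice x (π - x) with h | h <;> rw [h] <;> linarith

theorem intervalIntegrable_inv_sqrt_sin_pi :
    IntervalIntegrable (fun x ↦ 1 / √|sin x|) volume 0 π := by
  have h : IntervalIntegrable
      (fun x ↦ √(π / 2) * (x ^ (-(1 / 2) : ℝ) + (π - x) ^ (-(1 / 2) : ℝ))) volume 0 π := by
    refine (IntervalIntegrable.add (intervalIntegral.intervalIntegrable_rpow' (by norm_num))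
      ?_).const_mul _
    have := (intervalIntegral.intervalIntegrable_rpow' (a := 0) (b := π) (r := -(1 / 2))
      (by norm_num)).comp_sub_left π
    simpa using this.symm
  rw [intervalIntegrable_iff_integrableOn_Ioo_of_le pi_pos.le] at h ⊢
  refine Integrable.mono' h (Measurable.aestronglyMeasurable (by fun_prop)) ?_
  filter_upwards [ae_restrict_mem measurableSet_Ioo] with x hx
  rw [norm_of_nonneg (by positivity)]
  exact inv_sqrt_sin_le hx.1 hx.2

theorem intervalIntegrable_inv_sqrt_sin (a b : ℝ) :
    IntervalIntegrable (fun x ↦ 1 / √|sin x|) volume a b := by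
  have hper : Function.Periodic (fun x ↦ 1 / √|sin x|) π := fun x ↦ by simp [sin_add_pi]
  exact hper.intervalIntegrable₀ pi_pos.ne' intervalIntegrable_inv_sqrt_sin_pi a b

/-- The left side is the distance from the point of the circle to the line through 0 and a: rotate a
onto the real axis and take the imaginary part. -/
theorem mul_abs_sin_le_norm_circleMap_sub (r θ : ℝ) (a : ℂ) :
    |r| * |sin (θ - a.arg)| ≤ ‖circleMap 0 r θ - a‖ := by
  have h1 : ‖circleMap 0 r θ - a‖ = ‖(circleMap 0 r θ - a) * Complex.exp (-(a.arg : ℂ) * Complex.I)‖ := by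
    rw [norm_mul, ← Complex.ofReal_neg, Complex.norm_exp_ofReal_mul_I, mul_one]
  have h2 : (circleMap 0 r θ - a) * Complex.exp (-(a.arg : ℂ) * Complex.I)
      = r * Complex.exp (((θ - a.arg : ℝ) : ℂ) * Complex.I) - (‖a‖ : ℂ) := by
    have ha := Complex.norm_mul_exp_arg_mul_I a
    nth_rw 1 [← ha]
    rw [circleMap_zero, sub_mul, mul_assoc, mul_assoc, ← Complex.exp_add, ← Complex.exp_add]
    congr 2
    · push_cast; ring_nf
    · simp
  rw [h1, h2]
  refine le_trans (le_of_eq ?_) (Complex.abs_im_le_norm _)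
  rw [Complex.sub_im, Complex.ofReal_im, Complex.im_ofReal_mul, Complex.exp_ofReal_mul_I_im, sub_zero,
    abs_mul]

theorem inv_sqrt_norm_circleMap_sub_le {r θ : ℝ} (hr : 0 < r) {a : ℂ}
    (h : sin (θ - a.arg) ≠ 0) :
    1 / √‖circleMap 0 r θ - a‖ ≤ 1 / √r * (1 / √|sin (θ - a.arg)|) := by
  have h1 := mul_abs_sin_le_norm_circleMap_sub r θ a
  rw [abs_of_pos hr] at h1
  rw [one_div_mul_one_div, ← sqrt_mul hr.le]
  have : 0 < |sin (θ - a.arg)| := abs_pos.2 h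
  gcongr

theorem ae_sin_sub_ne_zero (c : ℝ) : ∀ᵐ θ : ℝ, sin (θ - c) ≠ 0 := by
  have h : {θ : ℝ | sin (θ - c) = 0} ⊆ Set.range fun n : ℤ ↦ n * π + c := by
    intro θ hθ
    obtain ⟨n, hn⟩ := sin_eq_zero_iff.1 hθ
    exact ⟨n, by simp [hn]⟩
  have h0 : volume {θ : ℝ | sin (θ - c) = 0} = 0 :=
    ((Set.countable_range _).mono h).measure_zero _
  exact measure_eq_zero_iff_ae_notMem.mp h0

theorem circleIntegrable_inv_sqrt_norm_sub {r : ℝ} (hr : 0 < r) (a : ℂ) :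
    CircleIntegrable (fun z ↦ 1 / √‖z - a‖) 0 r := by
  have h : IntervalIntegrable (fun θ ↦ 1 / √r * (1 / √|sin (θ - a.arg)|)) volume 0 (2 * π) := by
    have := (intervalIntegrable_inv_sqrt_sin (0 - a.arg) (2 * π - a.arg)).comp_sub_right a.arg
    simpa using this.const_mul (1 / √r)
  refine h.mono_fun (Measurable.aestronglyMeasurable (by fun_prop)) ?_
  filter_upwards [ae_restrict_of_ae (ae_sin_sub_ne_zero a.arg)] with θ hθ
  rw [norm_of_nonneg (by positivity), norm_of_nonneg (by positivity)]
  exact inv_sqrt_norm_circleMap_sub_le hr hθ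

/-- The mean of `z ↦ ‖z - a‖ ^ (-1/2)` over the circle of radius `1`, bounded uniformly in `a`. -/
noncomputable def invSqrtConst : ℝ := (2 * π)⁻¹ * ∫ θ in 0..2 * π, 1 / √|sin θ|

theorem invSqrtConst_nonneg : 0 ≤ invSqrtConst :=
  mul_nonneg (by positivity) (intervalIntegral.integral_nonneg two_pi_pos.le fun _ _ ↦ by positivity)

/-- The comparison with |sin(θ - arg a)|^{-1/2} involves a only through a translation, which
periodicity removes. -/
theorem circleAverage_inv_sqrt_norm_sub_le {r : ℝ} (hr : 0 < r) (a : ℂ) :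
    circleAverage (fun z ↦ 1 / √‖z - a‖) 0 r ≤ invSqrtConst / √r := by
  have hper : Function.Periodic (fun x ↦ 1 / √|sin x|) (2 * π) := fun x ↦ by simp
  have hI : IntervalIntegrable (fun θ ↦ 1 / √r * (1 / √|sin (θ - a.arg)|)) volume 0 (2 * π) := by
    have := (intervalIntegrable_inv_sqrt_sin (0 - a.arg) (2 * π - a.arg)).comp_sub_right a.arg
    simpa using this.const_mul (1 / √r)
  have h1 : ∫ θ in 0..2 * π, 1 / √‖circleMap 0 r θ - a‖
      ≤ ∫ θ in 0..2 * π, 1 / √r * (1 / √|sin (θ - a.arg)|) := by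
    apply intervalIntegral.integral_mono_ae two_pi_pos.le
      (circleIntegrable_inv_sqrt_norm_sub hr a) hI
    filter_upwards [ae_sin_sub_ne_zero a.arg] with θ hθ
    exact inv_sqrt_norm_circleMap_sub_le hr hθ
  have h2 : ∫ θ in 0..2 * π, (1 / √|sin (θ - a.arg)|) = ∫ θ in 0..2 * π, 1 / √|sin θ| := by
    rw [intervalIntegral.integral_comp_sub_right (fun x ↦ 1 / √|sin x|)]
    have := hper.intervalIntegral_add_eq (0 - a.arg) 0
    rw [zero_add] at this
    rw [← this]
    congr 1
    ring
  rw [intervalIntegral.integral_const_mul, h2] at h1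
  rw [circleAverage, smul_eq_mul, invSqrtConst, mul_div_assoc]
  calc _ ≤ (2 * π)⁻¹ * (1 / √r * ∫ θ in 0..2 * π, 1 / √|sin θ|) := by gcongr
    _ = _ := by ring

end SquareRootKernel

/-! ### Two-segment paths avoiding finitely many points. -/

section TentPath

open Complex

/-- Among `2 N + 1` equidistant slopes one keeps away from the directions of `N` given points. -/
theorem exists_slope (B : Finset ℂ) :
    ∃ t ∈ Set.Icc (0 : ℝ) 1, ∀ β ∈ B, ‖β‖ ≤ 8 * (B.card + 1) * |β.im - t * β.re| := by
  classical
  set N := B.card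
  by_contra! hcon
  have hN : (0 : ℝ) < N + 1 := by positivity
  have ht (k : Fin (N + 1)) : (k : ℝ) / (N + 1) ∈ Set.Icc (0 : ℝ) 1 := by
    refine ⟨by positivity, (div_le_one hN).2 ?_⟩
    exact_mod_cast k.2.le
  choose φ hφB hφ using fun k : Fin (N + 1) ↦ hcon _ (ht k)
  -- Pigeonhole: the N + 1 slopes k/(N + 1) fail at only N points, so two of them fail at the same
  -- β. They differ by at least 1/(N + 1), which forces |Re β| < |β|/4 and then |Im β| < 3|β|/8,
  -- against |β| ≤ |Re β| + |Im β|.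
  obtain ⟨k, -, l, -, hkl, he⟩ := Finset.exists_ne_map_eq_of_card_lt_of_maps_to
    (s := Finset.univ) (t := B) (f := φ) (by simp [N]) fun k _ ↦ hφB k
  have h1 := hφ k
  have h2 := hφ l
  rw [← he] at h2
  set β := φ k
  set t : ℝ := (k : ℝ) / (N + 1)
  set t' : ℝ := (l : ℝ) / (N + 1)
  have hdist : 1 ≤ (N + 1) * |t - t'| := by
    have : (N + 1) * |t - t'| = |((k : ℤ) - (l : ℤ) : ℤ)| := by
      have e : t - t' = ((k : ℝ) - l) / (N + 1) := by simp only [t, t']; ring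
      rw [e, abs_div, abs_of_pos hN]
      push_cast
      field_simp
    rw [this]
    have : (k : ℤ) - (l : ℤ) ≠ 0 := by
      intro h
      apply hkl
      ext
      omega
    exact_mod_cast Int.one_le_abs this
  have hab : |t - t'| * |β.re| ≤ |β.im - t * β.re| + |β.im - t' * β.re| := by
    rw [← abs_mul]
    calc |(t - t') * β.re| = |(β.im - t' * β.re) - (β.im - t * β.re)| := by ring_nf
      _ ≤ |β.im - t' * β.re| + |β.im - t * β.re| := abs_sub _ _
      _ = _ := add_comm _ _
  have hre : 4 * |β.re| < ‖β‖ := by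
    have : |β.re| ≤ (N + 1) * |t - t'| * |β.re| :=
      le_mul_of_one_le_left (abs_nonneg _) hdist
    nlinarith
  have him : |β.im| ≤ |β.re| + |β.im - t * β.re| := by
    have e : |β.im| ≤ |t * β.re| + |β.im - t * β.re| := by
      calc |β.im| = |t * β.re + (β.im - t * β.re)| := by ring_nf
        _ ≤ _ := abs_add_le _ _
    have : |t * β.re| ≤ |β.re| := by
      rw [abs_mul, abs_of_nonneg (ht k).1]
      exact mul_le_of_le_one_left (abs_nonneg _) (ht k).2
    linarith
  have hN1 : (1 : ℝ) ≤ N + 1 := by simp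
  have h8 : 8 * |β.im - t * β.re| ≤ 8 * (N + 1) * |β.im - t * β.re| := by
    nlinarith [abs_nonneg (β.im - t * β.re)]
  have := Complex.norm_le_abs_re_add_abs_im β
  linarith [norm_nonneg β]

/-- Multiplication by 1 - tI, of norm at most 2, makes the whole line of slope t real, so the
imaginary part bounds the distance from β to that line. -/
theorem norm_le_of_slope {β : ℂ} {t K s : ℝ} (ht : t ∈ Set.Icc (0 : ℝ) 1) (hK : 0 ≤ K)
    (h : ‖β‖ ≤ K * |β.im - t * β.re|) : ‖β‖ ≤ 2 * K * ‖s * (1 + t * I) - β‖ := by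
  have e : β.im - t * β.re = ((β - s * (1 + t * I)) * (1 - t * I)).im := by
    simp
    ring
  have h1 : ‖(1 : ℂ) - t * I‖ ≤ 2 := by
    refine (norm_sub_le _ _).trans ?_
    rw [norm_one, norm_mul, norm_I, mul_one, norm_real, Real.norm_of_nonneg ht.1]
    linarith [ht.2]
  have h2 : |β.im - t * β.re| ≤ ‖s * (1 + t * I) - β‖ * 2 := by
    rw [e]
    refine (abs_im_le_norm _).trans ?_
    rw [norm_mul, norm_sub_rev]
    gcongr
  calc ‖β‖ ≤ K * (‖s * (1 + t * I) - β‖ * 2) := h.trans (by gcongr)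
    _ = _ := by ring

/-- Two points are joined by a two-segment path that stays away from a given finite set. -/
theorem exists_tent (S : Finset ℂ) {z z' : ℂ} (hne : z ≠ z') :
    ∃ m : ℂ, ‖m - z‖ ≤ ‖z' - z‖ ∧ ‖m - z'‖ ≤ ‖z' - z‖ ∧
      (∀ w ∈ segment ℝ z m, ∀ b ∈ S, ‖z - b‖ ≤ 16 * (2 * S.card + 1) * ‖w - b‖) ∧
      (∀ w ∈ segment ℝ z' m, ∀ b ∈ S, ‖z' - b‖ ≤ 16 * (2 * S.card + 1) * ‖w - b‖) := by
  classical
  have hd : z' - z ≠ 0 := sub_ne_zero.2 hne.symm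
  have hd' : 0 < ‖z' - z‖ := norm_pos_iff.2 hd
  -- Each leg is normalised so that its starting point is 0 and the other endpoint is 1. The apex is
  -- (1 + tI)/2 seen from z and (1 - tI)/2 seen from z'; conjugating the second picture lets one
  -- slope t serve both legs, at the price of 2|S| points.
  set B := S.image (fun b ↦ (b - z) / (z' - z)) ∪
    S.image fun b ↦ (starRingEnd ℂ) ((b - z') / (z - z')) with hB
  obtain ⟨t, ht, h⟩ := exists_slope B
  have hcard : (B.card : ℝ) ≤ 2 * S.card := by
    have : B.card ≤ S.card + S.card := (Finset.card_union_le _ _).trans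
      (add_le_add Finset.card_image_le Finset.card_image_le)
    have : (B.card : ℝ) ≤ S.card + S.card := by exact_mod_cast this
    linarith
  have hK : (8 : ℝ) * (B.card + 1) ≤ 8 * (2 * S.card + 1) := by linarith
  have hnorm (s : ℝ) (hs : |s| ≤ 1) : ‖(1 + s * I) / 2‖ ≤ 1 := by
    rw [norm_div, Complex.norm_two, div_le_one two_pos]
    refine (norm_add_le _ _).trans ?_
    rw [norm_one, norm_mul, norm_I, mul_one, norm_real, Real.norm_eq_abs]
    linarith
  have ht1 : |t| ≤ 1 := abs_le.2 ⟨by linarith [ht.1], ht.2⟩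
  refine ⟨z + (z' - z) * ((1 + t * I) / 2), ?_, ?_, ?_, ?_⟩
  · rw [add_sub_cancel_left, norm_mul]
    exact mul_le_of_le_one_right hd'.le (hnorm t ht1)
  · have e : z + (z' - z) * ((1 + t * I) / 2) - z' = (z' - z) * (-((1 + (-t : ℝ) * I) / 2)) := by
      push_cast; ring
    rw [e, norm_mul, norm_neg]
    exact mul_le_of_le_one_right hd'.le (hnorm (-t) (by rwa [abs_neg]))
  · intro w hw b hb
    rw [segment_eq_image'] at hw
    obtain ⟨s, -, rfl⟩ := hw
    have h1 := h ((b - z) / (z' - z))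
      (Finset.mem_union_left _ (Finset.mem_image_of_mem _ hb))
    have h2 := norm_le_of_slope (s := s / 2) ht (by positivity) h1
    have e : z + s • (z + (z' - z) * ((1 + t * I) / 2) - z) - b
        = (z' - z) * (((s / 2 : ℝ) : ℂ) * (1 + t * I) - (b - z) / (z' - z)) := by
      rw [real_smul]
      field_simp
      push_cast
      ring
    simp only
    rw [e, norm_mul, norm_sub_rev z b]
    rw [norm_div, div_le_iff₀ hd'] at h2
    refine h2.trans ?_
    calc _ ≤ 2 * (8 * (2 * S.card + 1)) *
          ‖((s / 2 : ℝ) : ℂ) * (1 + t * I) - (b - z) / (z' - z)‖ * ‖z' - z‖ := by gcongr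
      _ = _ := by ring
  · intro w hw b hb
    rw [segment_eq_image'] at hw
    obtain ⟨s, -, rfl⟩ := hw
    have h1 := h ((starRingEnd ℂ) ((b - z') / (z - z')))
      (Finset.mem_union_right _ (Finset.mem_image_of_mem
        (fun b ↦ (starRingEnd ℂ) ((b - z') / (z - z'))) hb))
    have h2 := norm_le_of_slope (s := s / 2) ht (by positivity) h1
    have hd2 : z - z' ≠ 0 := sub_ne_zero.2 hne
    have e : z' + s • (z + (z' - z) * ((1 + t * I) / 2) - z') - b
        = (z - z') * (starRingEnd ℂ) (((s / 2 : ℝ) : ℂ) * (1 + t * I) -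
          (starRingEnd ℂ) ((b - z') / (z - z'))) := by
      rw [map_sub, map_mul, conj_conj, map_add, map_mul, conj_ofReal, conj_ofReal, conj_I, map_one,
        real_smul]
      field_simp
      push_cast
      ring
    simp only
    rw [e, norm_mul, norm_conj, norm_sub_rev z' b, norm_sub_rev z z']
    rw [norm_conj, norm_div, norm_sub_rev z z', div_le_iff₀ hd'] at h2
    refine h2.trans ?_
    calc _ ≤ 2 * (8 * (2 * S.card + 1)) * ‖((s / 2 : ℝ) : ℂ) * (1 + t * I) -
          (starRingEnd ℂ) ((b - z') / (z - z'))‖ * ‖z' - z‖ := by gcongr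
      _ = _ := by ring

end TentPath

/-! ### Counting zeros and poles, and factoring them out. -/

section Counting

open Real Metric MeromorphicOn Function

/-- The zeros and poles of `F` in the closed disc of radius `R`. -/
noncomputable def zerosPoles (F : ℂ → ℂ) (R : ℝ) : Finset ℂ :=
  ((divisor F (closedBall 0 R)).finiteSupport (isCompact_closedBall 0 R)).toFinset

/-- The number of zeros and poles of `F` in the closed disc of radius `R`, with multiplicity. -/
noncomputable def zerosPolesCount (F : ℂ → ℂ) (R : ℝ) : ℝ :=
  ∑ u ∈ zerosPoles F R, |(divisor F (closedBall 0 R) u : ℝ)|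

/-- The constant in the First Main Theorem for `F` and `F⁻¹`. -/
noncomputable def fmtConst (F : ℂ → ℂ) : ℝ := |log ‖meromorphicTrailingCoeffAt F 0‖|

theorem fmtConst_nonneg (F : ℂ → ℂ) : 0 ≤ fmtConst F := abs_nonneg _

theorem zerosPolesCount_nonneg (F : ℂ → ℂ) (R : ℝ) : 0 ≤ zerosPolesCount F R :=
  Finset.sum_nonneg fun _ _ ↦ abs_nonneg _

theorem mem_zerosPoles {F : ℂ → ℂ} {R : ℝ} {u : ℂ} :
    u ∈ zerosPoles F R ↔ divisor F (closedBall 0 R) u ≠ 0 := by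
  simp [zerosPoles]

theorem norm_le_of_mem_zerosPoles {F : ℂ → ℂ} {R : ℝ} {u : ℂ} (hu : u ∈ zerosPoles F R) :
    ‖u‖ ≤ R := by
  by_contra h
  exact mem_zerosPoles.1 hu (locallyFinsuppWithin.apply_eq_zero_of_notMem _ (by simpa using h))

theorem card_zerosPoles_le (F : ℂ → ℂ) (R : ℝ) :
    ((zerosPoles F R).card : ℝ) ≤ zerosPolesCount F R := by
  rw [zerosPolesCount, Finset.card_eq_sum_ones]
  push_cast
  refine Finset.sum_le_sum fun u hu ↦ ?_
  exact_mod_cast Int.one_le_abs (mem_zerosPoles.1 hu)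

theorem divisor_closedBall_eq_univ {F : ℂ → ℂ} (hF : Meromorphic F) {R : ℝ} {u : ℂ} (hu : ‖u‖ ≤ R) :
    divisor F (closedBall 0 R) u = divisor F Set.univ u := by
  rw [divisor_apply hF.meromorphicOn (by simpa using hu),
    divisor_apply hF.meromorphicOn (Set.mem_univ u)]

/-- Each nonzero point of S contributes log(R'/|u|) ≥ log(R'/R) with its multiplicity. The origin
contributes log R', which is large enough because R ≥ 1. -/
theorem sum_mul_log_le_logCounting {E : locallyFinsupp ℂ ℤ} (hE : 0 ≤ E) {R R' : ℝ} (hR : 1 ≤ R)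
    (hRR' : R ≤ R') {S : Finset ℂ} (hS : ∀ u ∈ S, ‖u‖ ≤ R) :
    (∑ u ∈ S, (E u : ℝ)) * log (R' / R) ≤ locallyFinsuppWithin.logCounting E R' := by
  classical
  have hR' : 0 < R' := by linarith
  have hE' (u : ℂ) : (0 : ℝ) ≤ E u := by exact_mod_cast hE u
  have hlogRR : log (R' / R) ≤ log R' := by
    apply log_le_log (by positivity)
    exact div_le_self hR'.le hR
  have hlogR' : 0 ≤ log R' := log_nonneg (hR.trans hRR')
  have hfin : ((E.toClosedBall R').support).Finite :=
    (E.toClosedBall R').finiteSupport (isCompact_closedBall 0 |R'|)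
  have hsub : (Function.support fun z ↦ ((E.toClosedBall R' z : ℤ) : ℝ) * log (R' * ‖z‖⁻¹))
      ⊆ ((hfin.toFinset ∪ S.erase 0 : Finset ℂ) : Set ℂ) := by
    intro z hz
    simp only [Finset.coe_union, Set.Finite.coe_toFinset, Set.mem_union]
    left
    simp only [Function.mem_support] at hz ⊢
    intro h0
    simp [h0] at hz
  have hmem (u : ℂ) (hu : ‖u‖ ≤ R') : E.toClosedBall R' u = E u :=
    locallyFinsuppWithin.toClosedBall_eval_within E (by simpa [abs_of_pos hR'] using hu)
  have hnn (z : ℂ) : 0 ≤ ((E.toClosedBall R' z : ℤ) : ℝ) * log (R' * ‖z‖⁻¹) := by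
    by_cases hz : ‖z‖ ≤ R'
    · rw [hmem z hz]
      rcases eq_or_ne z 0 with rfl | h0
      · simp
      · refine mul_nonneg (hE' z) (log_nonneg ?_)
        rw [← div_eq_mul_inv, one_le_div (norm_pos_iff.2 h0)]
        exact hz
    · rw [locallyFinsuppWithin.apply_eq_zero_of_notMem _ (by simpa [abs_of_pos hR'] using hz)]
      simp
  have h1 : ∑ u ∈ S.erase 0, (E u : ℝ) * log (R' / R)
      ≤ ∑ᶠ z, ((E.toClosedBall R' z : ℤ) : ℝ) * log (R' * ‖z‖⁻¹) := by
    rw [finsum_eq_sum_of_support_subset _ hsub]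
    refine le_trans ?_ (Finset.sum_le_sum_of_subset_of_nonneg Finset.subset_union_right
      fun z _ _ ↦ hnn z)
    refine Finset.sum_le_sum fun u hu ↦ ?_
    have hu0 : u ≠ 0 := Finset.ne_of_mem_erase hu
    have huR := hS u (Finset.mem_of_mem_erase hu)
    rw [hmem u (huR.trans hRR')]
    have : 0 < ‖u‖ := norm_pos_iff.2 hu0
    apply mul_le_mul_of_nonneg_left _ (hE' u)
    rw [div_eq_mul_inv]
    apply log_le_log (by positivity)
    gcongr
  have h2 : ∑ u ∈ S, (E u : ℝ) * log (R' / R) ≤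
      ∑ u ∈ S.erase 0, (E u : ℝ) * log (R' / R) + E 0 * log R' := by
    by_cases h : (0 : ℂ) ∈ S
    · rw [← Finset.add_sum_erase S _ h, add_comm]
      gcongr
      exact hE' 0
    · rw [Finset.erase_eq_of_notMem h]
      linarith [mul_nonneg (hE' 0) hlogR']
  rw [Finset.sum_mul]
  refine h2.trans ?_
  change _ ≤ ∑ᶠ z, ((E.toClosedBall R' z : ℤ) : ℝ) * log (R' * ‖z‖⁻¹) + E 0 * log R'
  gcongr

theorem characteristic_inv_le {F : ℂ → ℂ} (hF : Meromorphic F) {R : ℝ} (hR : R ≠ 0) :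
    characteristic F⁻¹ ⊤ R ≤ characteristic F ⊤ R + fmtConst F := by
  have := characteristic_sub_characteristic_inv_of_ne_zero hF hR
  have h2 := neg_abs_le (log ‖meromorphicTrailingCoeffAt F 0‖)
  rw [fmtConst]
  linarith

theorem logCounting_top_le_characteristic (F : ℂ → ℂ) (R : ℝ) :
    logCounting F ⊤ R ≤ characteristic F ⊤ R :=
  le_add_of_nonneg_left (proximity_nonneg R)

theorem proximity_top_le_characteristic (F : ℂ → ℂ) {R : ℝ} (hR : 1 ≤ R) :
    proximity F ⊤ R ≤ characteristic F ⊤ R :=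
  le_add_of_nonneg_right (logCounting_nonneg hR)

theorem logCounting_zero_le_characteristic {F : ℂ → ℂ} (hF : Meromorphic F) {R : ℝ} (hR : R ≠ 0) :
    logCounting F 0 R ≤ characteristic F ⊤ R + fmtConst F := by
  rw [← logCounting_inv]
  exact (logCounting_top_le_characteristic _ _).trans (characteristic_inv_le hF hR)

theorem zerosPolesCount_mul_log_le {F : ℂ → ℂ} (hF : Meromorphic F) {R R' : ℝ} (hR : 1 ≤ R)
    (hRR' : R ≤ R') :
    zerosPolesCount F R * log (R' / R) ≤ 2 * characteristic F ⊤ R' + fmtConst F := by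
  set D := divisor F Set.univ
  have hE : (0 : locallyFinsupp ℂ ℤ) ≤ D⁺ + D⁻ := add_nonneg (posPart_nonneg D) (negPart_nonneg D)
  have h1 := sum_mul_log_le_logCounting hE hR hRR' (S := zerosPoles F R)
    fun u hu ↦ norm_le_of_mem_zerosPoles hu
  have h2 : zerosPolesCount F R = ∑ u ∈ zerosPoles F R, (((D⁺ + D⁻ : locallyFinsupp ℂ ℤ) u : ℤ) : ℝ) := by
    refine Finset.sum_congr rfl fun u hu ↦ ?_
    rw [divisor_closedBall_eq_univ hF (norm_le_of_mem_zerosPoles hu), ← Int.cast_abs]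
    congr 1
    simp only [locallyFinsuppWithin.coe_add, Pi.add_apply, locallyFinsuppWithin.posPart_apply,
      locallyFinsuppWithin.negPart_apply]
    exact (posPart_add_negPart (D u)).symm
  rw [h2]
  refine h1.trans ?_
  rw [map_add, Pi.add_apply, ← logCounting_zero, ← logCounting_top]
  have := logCounting_zero_le_characteristic hF (R := R') (by linarith)
  have := logCounting_top_le_characteristic F R'
  linarith

theorem zerosPolesCount_le {F : ℂ → ℂ} (hF : Meromorphic F) {R R' : ℝ} (hR : 1 ≤ R)
    (hRR' : R < R') :
    zerosPolesCount F R ≤ (2 * characteristic F ⊤ R' + fmtConst F) * (R' / (R' - R)) := by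
  have h := zerosPolesCount_mul_log_le hF hR hRR'.le
  have hpos : 0 < R' / R := div_pos (by linarith) (by linarith)
  have h1 := one_sub_inv_le_log_of_pos hpos
  have h2 : 1 - (R' / R)⁻¹ = (R' - R) / R' := by
    rw [inv_div, sub_div, div_self (by linarith)]
  rw [h2] at h1
  have h3 := (mul_le_mul_of_nonneg_left h1 (zerosPolesCount_nonneg F R)).trans h
  have h4 : 0 < R' - R := by linarith
  have h5 : 0 < R' := by linarith
  rw [← mul_div_assoc, div_le_iff₀ h5] at h3
  rw [← mul_div_assoc, le_div_iff₀ h4]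
  exact h3

/-- Use |log x| = log⁺ x + log⁺(1/x) and the First Main Theorem for the second term. -/
theorem circleAverage_abs_log_norm_le {F : ℂ → ℂ} (hF : Meromorphic F) {R : ℝ} (hR : 1 ≤ R) :
    circleAverage (fun z ↦ |log ‖F z‖|) 0 R ≤ 2 * characteristic F ⊤ R + fmtConst F := by
  have h : (fun z ↦ |log ‖F z‖|) = (log⁺ ‖F ·‖) + (log⁺ ‖F⁻¹ ·‖) := by
    ext z
    simp only [Pi.add_apply, Pi.inv_apply, norm_inv]
    have h1 := half_mul_log_add_log_abs (x := ‖F z‖)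
    have h2 := half_mul_log_add_log_abs (x := ‖F z‖⁻¹)
    rw [log_inv, abs_neg] at h2
    linarith
  rw [h, circleAverage_add hF.meromorphicOn.circleIntegrable_posLog_norm
    hF.inv.meromorphicOn.circleIntegrable_posLog_norm, ← proximity_top, ← proximity_top]
  have h1 := proximity_top_le_characteristic F hR
  have h2 := proximity_top_le_characteristic F⁻¹ hR
  have h3 := characteristic_inv_le hF (R := R) (by linarith)
  linarith

theorem eq_of_eventuallyEq_codiscreteWithin {F G : ℂ → ℂ} {R : ℝ} {z : ℂ}
    (h : F =ᶠ[codiscreteWithin (closedBall 0 R)] G) (hz : z ∈ ball (0 : ℂ) R)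
    (hF : ContinuousAt F z) (hG : ContinuousAt G z) : F z = G z := by
  have h1 : F =ᶠ[𝓝[≠] z] G := by
    have h2 := mem_codiscreteWithin_iff_forall_mem_nhdsNE.1 h z (ball_subset_closedBall hz)
    filter_upwards [h2, nhdsWithin_le_nhds (isOpen_ball.mem_nhds hz)] with w hw hwb
    rcases hw with hw | hw
    · exact hw
    · exact absurd (ball_subset_closedBall hwb) hw
  exact ((hF.eventuallyEq_nhds_iff_eventuallyEq_nhdsNE hG).1 h1).eq_of_nhds

/-- Off a finite set log|g| = log|F| - ∑ D(u) log|z - u|, and each term on the right has a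
controlled mean. -/
theorem circleAverage_abs_log_norm_factor_le {F g : ℂ → ℂ} (hF : Meromorphic F) {R : ℝ} (hR : 1 ≤ R)
    (hg : AnalyticOnNhd ℂ g (closedBall 0 R)) (hg0 : ∀ z ∈ closedBall (0 : ℂ) R, g z ≠ 0)
    {S : Finset ℂ} {D : ℂ → ℤ} (hS : ∀ u ∈ S, ‖u‖ ≤ R)
    (hfg : F =ᶠ[codiscreteWithin (closedBall 0 R)] fun z ↦ (∏ u ∈ S, (z - u) ^ D u) * g z) :
    circleAverage (fun z ↦ |log ‖g z‖|) 0 R ≤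
      2 * characteristic F ⊤ R + fmtConst F + (∑ u ∈ S, |(D u : ℝ)|) * (2 * log (2 * R)) := by
  have hR0 : 0 < R := by linarith
  have hcont : ContinuousOn (fun ζ ↦ log ‖g ζ‖) (sphere 0 |R|) := by
    rw [abs_of_pos hR0]
    intro x hx
    have hx' := sphere_subset_closedBall hx
    exact ((hg x hx').continuousAt.norm.log
      (norm_ne_zero_iff.2 (hg0 x hx'))).continuousWithinAt
  have hterm : ∀ u ∈ S, CircleIntegrable (fun z ↦ |(D u : ℝ)| • |log ‖z - u‖|) 0 R :=
    fun u _ ↦ ((circleIntegrable_log_norm_sub u R).abs).const_smul (a := |(D u : ℝ)|)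
  have hsumint : CircleIntegrable
      (fun z ↦ ∑ u ∈ S, |(D u : ℝ)| • |log ‖z - u‖|) 0 R := by
    have := CircleIntegrable.sum (c := 0) (R := R) S hterm
    convert! this using 1
    ext z
    simp
  have hFint : CircleIntegrable (fun z ↦ |log ‖F z‖|) 0 R :=
    (hF.meromorphicOn.circleIntegrable_log_norm).abs
  have h1 : circleAverage (fun z ↦ |log ‖g z‖|) 0 R ≤ circleAverage (fun z ↦ |log ‖F z‖| +
      ∑ u ∈ S, |(D u : ℝ)| • |log ‖z - u‖|) 0 R := by
    set B := closedBall (0 : ℂ) R \ {z | F z = (∏ u ∈ S, (z - u) ^ D u) * g z}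
    have hBfin : B.Finite :=
      (isCompact_closedBall (0 : ℂ) R).finite_sdiff_of_mem_codiscreteWithin hfg
    refine circleAverage_mono_of_countable hR0.ne'
      (S := (B ∪ S : Set ℂ)) (hBfin.union (Finset.finite_toSet _)).countable
      (hcont.abs.circleIntegrable') (hFint.add hsumint) ?_
    intro z hz hzS
    simp only [Set.mem_union, not_or] at hzS
    have hzR : z ∈ closedBall (0 : ℂ) R := by
      rw [abs_of_pos hR0] at hz; exact sphere_subset_closedBall hz
    have hzF : F z = (∏ u ∈ S, (z - u) ^ D u) * g z := by
      by_contra h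
      exact hzS.1 ⟨hzR, h⟩
    have hne : ∀ u ∈ S, ‖(z - u) ^ D u‖ ≠ 0 := fun u hu ↦
      norm_ne_zero_iff.2 (zpow_ne_zero _ (sub_ne_zero.2 fun h ↦ hzS.2 (h ▸ hu)))
    have hlog : log ‖F z‖ = ∑ u ∈ S, D u * log ‖z - u‖ + log ‖g z‖ := by
      rw [hzF, norm_mul, norm_prod, log_mul (Finset.prod_ne_zero_iff.2 hne)
        (norm_ne_zero_iff.2 (hg0 z hzR)), log_prod hne]
      simp [norm_zpow, log_zpow]
    have h2 : log ‖g z‖ = log ‖F z‖ - ∑ u ∈ S, D u * log ‖z - u‖ := by linarith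
    rw [h2]
    refine (abs_sub _ _).trans ?_
    gcongr
    refine (Finset.abs_sum_le_sum_abs _ _).trans (le_of_eq ?_)
    simp [abs_mul]
  refine h1.trans ?_
  rw [circleAverage_fun_add hFint hsumint, circleAverage_fun_sum hterm]
  refine add_le_add (circleAverage_abs_log_norm_le hF hR) ?_
  rw [Finset.sum_mul]
  refine Finset.sum_le_sum fun u hu ↦ ?_
  rw [circleAverage_fun_smul, smul_eq_mul]
  gcongr
  exact circleAverage_abs_log_norm_sub_le hR le_rfl (hS u hu)

theorem finprod_sub_zpow_eq {D : ℂ → ℤ} {S : Finset ℂ} (hS : Function.support D ⊆ S) :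
    (∏ᶠ u, (fun z : ℂ ↦ z - u) ^ D u) = fun z ↦ ∏ u ∈ S, (z - u) ^ D u := by
  rw [finprod_eq_prod_of_mulSupport_subset (s := S)]
  · ext z
    simp
  · intro u hu
    rw [FactorizedRational.mulSupport] at hu
    exact hS hu

/-- Splitting off zeros and poles, with a bound for the logarithm of the remaining factor. -/
theorem exists_factorization {F : ℂ → ℂ} (hF : Meromorphic F)
    (hF0 : ∀ z, meromorphicOrderAt F z ≠ ⊤) {R : ℝ} (hR : 1 ≤ R) :
    ∃ g : ℂ → ℂ, AnalyticOnNhd ℂ g (closedBall 0 R) ∧ (∀ z ∈ closedBall (0 : ℂ) R, g z ≠ 0) ∧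
      circleAverage (fun z ↦ |log ‖g z‖|) 0 R ≤
        2 * characteristic F ⊤ R + fmtConst F + zerosPolesCount F R * (2 * log (2 * R)) ∧
      ∀ z ∈ ball (0 : ℂ) R, AnalyticAt ℂ F z → z ∉ zerosPoles F R →
        F z = (∏ u ∈ zerosPoles F R, (z - u) ^ divisor F (closedBall 0 R) u) * g z := by
  set D := divisor F (closedBall 0 R) with hD
  have hfin : D.support.Finite := D.finiteSupport (isCompact_closedBall 0 R)
  obtain ⟨g, hg, hg0, hfg⟩ := MeromorphicOn.extract_zeros_poles (U := closedBall (0 : ℂ) R)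
    hF.meromorphicOn (fun u ↦ hF0 u) hfin
  rw [finprod_sub_zpow_eq (S := zerosPoles F R) fun u hu ↦ mem_zerosPoles.2 hu] at hfg
  have hg0' : ∀ z ∈ closedBall (0 : ℂ) R, g z ≠ 0 := fun z hz ↦ hg0 ⟨z, hz⟩
  refine ⟨g, hg, hg0', circleAverage_abs_log_norm_factor_le hF hR hg hg0'
    (fun u hu ↦ norm_le_of_mem_zerosPoles hu) hfg, ?_⟩
  intro z hz hzF hzS
  refine eq_of_eventuallyEq_codiscreteWithin hfg hz hzF.continuousAt ?_
  refine ContinuousAt.smul ?_ (hg z (ball_subset_closedBall hz)).continuousAt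
  refine tendsto_finsetProd _ fun u hu ↦ ?_
  exact ContinuousAt.zpow₀ (by fun_prop) _ (Or.inl (sub_ne_zero.2 fun h ↦ hzS (h ▸ hu)))

end Counting

/-! ### Orders of zeros and poles of the derivative. -/

section DerivativeOrder

open Function

theorem meromorphicOrderAt_deriv_nonneg {f : ℂ → ℂ} {z : ℂ} (hf : MeromorphicAt f z)
    (h : 0 ≤ meromorphicOrderAt f z) : 0 ≤ meromorphicOrderAt (deriv f) z := by
  obtain ⟨g, hg, hfg⟩ := hf.meromorphicOrderAt_nonneg_iff.1 h
  rw [meromorphicOrderAt_congr hfg.nhdsNE_deriv]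
  exact hg.deriv.meromorphicOrderAt_nonneg

theorem meromorphicOrderAt_nonneg_of_deriv {f : ℂ → ℂ} {z : ℂ}
    (h : 0 ≤ meromorphicOrderAt (deriv f) z) : 0 ≤ meromorphicOrderAt f z := by
  by_contra! hlt
  obtain ⟨n, hn⟩ := WithTop.ne_top_iff_exists.1 (hlt.trans (WithTop.coe_lt_top 0)).ne
  rw [← hn] at hlt
  have hn0 : n < 0 := by exact_mod_cast hlt
  rw [meromorphicOrderAt_deriv_eq_sub_one (n := n) (by exact_mod_cast hn0.ne) hn.symm] at h
  have : 0 ≤ n - 1 := by exact_mod_cast h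
  omega

/-- A pole of f is a pole of f', and normal form rules out a wrong value at a removable point. Hence
a path avoiding the zeros and poles of f' stays where f is analytic. -/
theorem MeromorphicNFAt.analyticAt_of_deriv {f : ℂ → ℂ} {z : ℂ} (hf : MeromorphicNFAt f z)
    (h : 0 ≤ meromorphicOrderAt (deriv f) z) : AnalyticAt ℂ f z :=
  hf.meromorphicOrderAt_nonneg_iff_analyticAt.1 (meromorphicOrderAt_nonneg_of_deriv h)

theorem eventuallyEq_codiscrete_of_forall_nhdsNE {f g : ℂ → ℂ} (h : ∀ x, f =ᶠ[𝓝[≠] x] g) :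
    f =ᶠ[codiscrete ℂ] g := by
  refine mem_codiscreteWithin_iff_forall_mem_nhdsNE.2 fun x _ ↦ ?_
  filter_upwards [h x] with w hw using Or.inl hw

theorem nhdsNE_of_eventuallyEq_codiscrete {f g : ℂ → ℂ} (h : f =ᶠ[codiscrete ℂ] g) (x : ℂ) :
    f =ᶠ[𝓝[≠] x] g := by
  have := mem_codiscreteWithin_iff_forall_mem_nhdsNE.1 h x (Set.mem_univ x)
  filter_upwards [this] with w hw
  simpa using hw

theorem isConstantMero_of_meromorphicOrderAt_sub_eq_top {f : ℂ → ℂ} (hf : Meromorphic f) {c z : ℂ}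
    (h : meromorphicOrderAt (fun w ↦ f w - c) z = ⊤) : IsConstantMero f := by
  have hm : Meromorphic (fun w ↦ f w - c) := by fun_prop
  have hall : ∀ u, meromorphicOrderAt (fun w ↦ f w - c) u = ⊤ := by
    intro u
    by_contra hu
    exact hm.exists_meromorphicOrderAt_ne_top_iff_forall.1 ⟨u, hu⟩ z h
  refine ⟨c, eventuallyEq_codiscrete_of_forall_nhdsNE fun x ↦ ?_⟩
  filter_upwards [meromorphicOrderAt_eq_top_iff.1 (hall x)] with w hw using sub_eq_zero.1 hw

theorem meromorphicOrderAt_ne_top_of_not_isConstantMero {f : ℂ → ℂ} (hf : Meromorphic f)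
    (hc : ¬ IsConstantMero f) (z : ℂ) : meromorphicOrderAt f z ≠ ⊤ := fun h ↦
  hc (isConstantMero_of_meromorphicOrderAt_sub_eq_top hf (c := 0) (z := z) (by simpa using h))

theorem meromorphicOrderAt_deriv_ne_top {f : ℂ → ℂ} (hf : Meromorphic f)
    (hc : ¬ IsConstantMero f) (z : ℂ) : meromorphicOrderAt (deriv f) z ≠ ⊤ := by
  intro h
  have hall : ∀ u, meromorphicOrderAt (deriv f) u = ⊤ := by
    intro u
    by_contra hu
    exact hf.deriv.exists_meromorphicOrderAt_ne_top_iff_forall.1 ⟨u, hu⟩ z h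
  obtain ⟨x, hx⟩ : ∃ x, AnalyticAt ℂ f x :=
    (MeromorphicAt.eventually_analyticAt (hf 0)).exists
  have h0 : deriv f =ᶠ[𝓝 x] 0 := by
    have h1 := meromorphicOrderAt_eq_top_iff.1 (hall x)
    exact (hx.deriv.continuousAt.eventuallyEq_nhds_iff_eventuallyEq_nhdsNE
      continuousAt_const).1 h1
  obtain ⟨ε, hε, hball⟩ := Metric.eventually_nhds_iff_ball.1 (h0.and hx.eventually_analyticAt)
  refine hc (isConstantMero_of_meromorphicOrderAt_sub_eq_top hf (c := f x) (z := x)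
    (meromorphicOrderAt_eq_top_iff.2 ?_))
  filter_upwards [nhdsWithin_le_nhds (Metric.ball_mem_nhds x hε)] with w hw
  rw [sub_eq_zero]
  exact Metric.isOpen_ball.is_const_of_deriv_eq_zero (convex_ball x ε).isPreconnected
    (fun y hy ↦ (hball y hy).2.differentiableAt.differentiableWithinAt)
    (fun y hy ↦ (hball y hy).1) hw (Metric.mem_ball_self hε)

/-- A pole of order k of f becomes one of order k + 1 ≤ 2k, and no other poles arise. -/
theorem logCounting_deriv_top_le {f : ℂ → ℂ} (hf : Meromorphic f)
    (hf0 : ∀ z, meromorphicOrderAt f z ≠ ⊤) {r : ℝ} (hr : 1 ≤ r) :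
    logCounting (deriv f) ⊤ r ≤ 2 * logCounting f ⊤ r := by
  rw [logCounting_top, logCounting_top]
  have hle : (MeromorphicOn.divisor (deriv f) Set.univ)⁻ ≤
      (MeromorphicOn.divisor f Set.univ)⁻ + (MeromorphicOn.divisor f Set.univ)⁻ := by
    intro z
    simp only [locallyFinsuppWithin.coe_add, Pi.add_apply, locallyFinsuppWithin.negPart_apply]
    rw [MeromorphicOn.divisor_apply hf.meromorphicOn (Set.mem_univ z),
      MeromorphicOn.divisor_apply hf.deriv.meromorphicOn (Set.mem_univ z)]
    obtain ⟨n, hn⟩ := WithTop.ne_top_iff_exists.1 (hf0 z)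
    rw [← hn, WithTop.untop₀_coe]
    rcases lt_or_ge n 0 with h | h
    · rw [meromorphicOrderAt_deriv_eq_sub_one (n := n) (by exact_mod_cast h.ne) hn.symm,
        WithTop.untop₀_coe]
      simp only [negPart_def]
      have h1 : (-(n - 1) ⊔ 0 : ℤ) = 1 - n := by rw [sup_eq_left.2] <;> omega
      have h2 : (-n ⊔ 0 : ℤ) = - n := by rw [sup_eq_left.2]; omega
      rw [h1, h2]
      omega
    · have h1 := meromorphicOrderAt_deriv_nonneg (hf z) (by rw [← hn]; exact_mod_cast h)
      have h2 : 0 ≤ (meromorphicOrderAt (deriv f) z).untop₀ := WithTop.untop₀_nonneg.2 h1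
      rw [negPart_eq_zero.2 h2]
      exact add_nonneg (negPart_nonneg n) (negPart_nonneg n)
  refine (locallyFinsuppWithin.logCounting_le hle hr).trans (le_of_eq ?_)
  rw [map_add, Pi.add_apply, two_mul]

end DerivativeOrder

/-! ### The logarithmic derivative and the characteristic of f'. -/

section LogarithmicDerivative

open Real Metric MeromorphicOn

/-- Cauchy's estimate on the circle of radius (R - r)/2 about z, where Poisson's formula gives |g| ≤
|g(z)| exp Λ. -/
theorem log_norm_deriv_div_le {g : ℂ → ℂ} {R r : ℝ}
    (hg : AnalyticOnNhd ℂ g (closedBall 0 R)) (hg0 : ∀ z ∈ closedBall (0 : ℂ) R, g z ≠ 0)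
    (hr : 0 ≤ r) (hrR : r < R) {z : ℂ} (hz : ‖z‖ = r) :
    log⁺ ‖deriv g z / g z‖ ≤ 4 * R / (R - r) * circleAverage (fun ζ ↦ |log ‖g ζ‖|) 0 R +
      log⁺ (2 / (R - r)) := by
  set M := circleAverage (fun ζ ↦ |log ‖g ζ‖|) 0 R
  have hM : 0 ≤ M := circleAverage_nonneg_of_nonneg fun _ _ ↦ abs_nonneg _
  set ρ := (R - r) / 2 with hρ
  have hρ0 : 0 < ρ := by rw [hρ]; linarith
  set Λ := 4 * R / (R - r) * M
  have hΛ : 0 ≤ Λ := mul_nonneg (div_nonneg (by linarith) (by linarith)) hM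
  have hsub : closedBall z ρ ⊆ closedBall (0 : ℂ) ((R + r) / 2) := by
    intro w hw
    rw [mem_closedBall, dist_eq_norm] at hw
    rw [mem_closedBall_zero_iff]
    calc ‖w‖ = ‖z + (w - z)‖ := by ring_nf
      _ ≤ r + ρ := (norm_add_le _ _).trans (by rw [hz]; gcongr)
      _ = _ := by rw [hρ]; ring
  have hsubR : closedBall z ρ ⊆ closedBall (0 : ℂ) R :=
    hsub.trans (closedBall_subset_closedBall (by linarith))
  have hz0 : g z ≠ 0 := hg0 z (hsubR (mem_closedBall_self hρ0.le))
  have hbound : ∀ w ∈ sphere z ρ, ‖g w‖ ≤ ‖g z‖ * exp Λ := by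
    intro w hw
    have hwb := sphere_subset_closedBall hw
    have h1 := abs_log_norm_sub_log_norm_le hg hg0 (ρ := (R + r) / 2) (by linarith)
      (by simpa using hsub hwb) (z := z) (by linarith)
    rw [mem_sphere_iff_norm] at hw
    rw [hw] at h1
    have h2 : 2 * R * ρ / (R - (R + r) / 2) ^ 2 * M = Λ := by
      have : R - r ≠ 0 := by linarith
      simp only [Λ, hρ]
      rw [show R - (R + r) / 2 = (R - r) / 2 by ring]
      field_simp
      ring
    have hlog : log ‖g w‖ ≤ log ‖g z‖ + Λ := by
      have := (abs_le.1 h1).2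
      linarith
    have hw0 : 0 < ‖g w‖ := norm_pos_iff.2 (hg0 w (hsubR hwb))
    calc ‖g w‖ = exp (log ‖g w‖) := (exp_log hw0).symm
      _ ≤ exp (log ‖g z‖ + Λ) := exp_le_exp.2 hlog
      _ = _ := by rw [exp_add, exp_log (norm_pos_iff.2 hz0)]
  have hdiff : DiffContOnCl ℂ g (ball z ρ) := by
    apply DifferentiableOn.diffContOnCl
    rw [closure_ball z hρ0.ne']
    exact fun w hw ↦ (hg w (hsubR hw)).differentiableAt.differentiableWithinAt
  have hder := Complex.norm_deriv_le_of_forall_mem_sphere_norm_le hρ0 hdiff hbound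
  have hq : ‖deriv g z / g z‖ ≤ exp Λ * (2 / (R - r)) := by
    rw [norm_div, div_le_iff₀ (norm_pos_iff.2 hz0)]
    refine hder.trans (le_of_eq ?_)
    rw [hρ]
    have : R - r ≠ 0 := by linarith
    field_simp
  refine (posLog_le_posLog (norm_nonneg _) hq).trans (posLog_mul.trans ?_)
  gcongr
  rw [posLog_eq_log, log_exp]
  rw [abs_of_pos (exp_pos _)]
  exact one_le_exp hΛ

theorem logDeriv_prod_zpow {S : Finset ℂ} {d : ℂ → ℤ} {z : ℂ} (hz : z ∉ S) :
    logDeriv (fun w ↦ ∏ u ∈ S, (w - u) ^ d u) z = ∑ u ∈ S, d u * (z - u)⁻¹ := by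
  have hne (u : ℂ) (hu : u ∈ S) : z - u ≠ 0 := sub_ne_zero.2 fun h ↦ hz (h ▸ hu)
  rw [logDeriv_prod (f := fun u w ↦ (w - u) ^ d u)]
  · refine Finset.sum_congr rfl fun u _ ↦ ?_
    rw [logDeriv_fun_zpow (by fun_prop)]
    simp [logDeriv_apply]
  · exact fun u hu ↦ zpow_ne_zero _ (hne u hu)
  · exact fun u hu ↦ DifferentiableAt.zpow (by fun_prop) (Or.inl (hne u hu))

theorem posLog_norm_sum_inv_sub_le (F : ℂ → ℂ) (R : ℝ) (z : ℂ) :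
    log⁺ ‖∑ u ∈ zerosPoles F R, (divisor F (closedBall 0 R) u : ℂ) * (z - u)⁻¹‖ ≤
      2 * zerosPolesCount F R + ∑ u ∈ zerosPoles F R, |log ‖z - u‖| := by
  refine (posLog_norm_sum_le _ _).trans ?_
  have h1 : log (zerosPoles F R).card ≤ zerosPolesCount F R :=
    (log_le_self (by positivity)).trans (card_zerosPoles_le F R)
  have h2 : ∑ u ∈ zerosPoles F R, log⁺ ‖(divisor F (closedBall 0 R) u : ℂ) * (z - u)⁻¹‖
      ≤ zerosPolesCount F R + ∑ u ∈ zerosPoles F R, |log ‖z - u‖| := by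
    rw [zerosPolesCount, ← Finset.sum_add_distrib]
    refine Finset.sum_le_sum fun u _ ↦ ?_
    rw [norm_mul]
    refine posLog_mul.trans (add_le_add ?_ ?_)
    · rw [Complex.norm_intCast, posLog_abs, posLog_apply]
      refine max_le (abs_nonneg _) ?_
      rw [← log_abs]
      exact log_le_self (abs_nonneg _)
    · rw [norm_inv, posLog_apply, log_inv]
      exact max_le (abs_nonneg _) (neg_le_abs _)
  linarith

/-- A crude form of the lemma on the logarithmic derivative. -/
theorem proximity_logDeriv_le {F : ℂ → ℂ} (hF : Meromorphic F)
    (hF0 : ∀ z, meromorphicOrderAt F z ≠ ⊤) {r R : ℝ} (hr : 1 ≤ r) (hrR : r < R) :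
    proximity (fun z ↦ deriv F z / F z) ⊤ r ≤
      2 * zerosPolesCount F R + zerosPolesCount F R * (2 * log (2 * R)) +
      (4 * R / (R - r) * (2 * characteristic F ⊤ R + fmtConst F +
        zerosPolesCount F R * (2 * log (2 * R))) + log⁺ (2 / (R - r))) + log 2 := by
  have hr0 : 0 < r := by linarith
  have hR : 1 ≤ R := by linarith
  obtain ⟨g, hg, hg0, hM, hfac⟩ := exists_factorization hF hF0 hR
  set M' := 2 * characteristic F ⊤ R + fmtConst F + zerosPolesCount F R * (2 * log (2 * R))
  set D := divisor F (closedBall 0 R)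
  have hFq : Meromorphic (fun z ↦ deriv F z / F z) := hF.deriv.fun_div hF
  set A := closedBall (0 : ℂ) R \ {z | AnalyticAt ℂ F z}
  have hA : A.Finite := (isCompact_closedBall (0 : ℂ) R).finite_sdiff_of_mem_codiscreteWithin
    (hF.meromorphicOn.analyticAt_mem_codiscreteWithin)
  have hsumint : CircleIntegrable (fun z ↦ ∑ u ∈ zerosPoles F R, |log ‖z - u‖|) 0 r := by
    have := CircleIntegrable.sum (c := 0) (R := r) (zerosPoles F R)
      (f := fun u z ↦ |log ‖z - u‖|) fun u _ ↦ (circleIntegrable_log_norm_sub u r).abs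
    convert! this using 1
    ext z
    simp
  set K := 2 * zerosPolesCount F R + (4 * R / (R - r) * M' + log⁺ (2 / (R - r))) + log 2
  have h1 : proximity (fun z ↦ deriv F z / F z) ⊤ r ≤
      circleAverage (fun z ↦ K + ∑ u ∈ zerosPoles F R, |log ‖z - u‖|) 0 r := by
    rw [proximity_top]
    refine circleAverage_mono_of_countable hr0.ne' (S := (A ∪ zerosPoles F R : Set ℂ))
      (hA.union (Finset.finite_toSet _)).countable
      hFq.meromorphicOn.circleIntegrable_posLog_norm
      ((circleIntegrable_const _ _ _).add hsumint) ?_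
    intro z hz hzS
    simp only [Set.mem_union, not_or] at hzS
    have hzr : ‖z‖ = r := by simpa [abs_of_pos hr0] using hz
    have hzb : z ∈ ball (0 : ℂ) R := by simpa [hzr] using hrR
    have hzF : AnalyticAt ℂ F z := by
      by_contra h
      exact hzS.1 ⟨ball_subset_closedBall hzb, h⟩
    have hzS2 : z ∉ zerosPoles F R := hzS.2
    have hev : F =ᶠ[𝓝 z] fun z ↦ (∏ u ∈ zerosPoles F R, (z - u) ^ D u) * g z := by
      filter_upwards [hzF.eventually_analyticAt, isOpen_ball.mem_nhds hzb,
        (Finset.finite_toSet (zerosPoles F R)).isClosed.isOpen_compl.mem_nhds hzS2]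
        with w h1 h2 h3 using hfac w h2 h1 h3
    have hne (u : ℂ) (hu : u ∈ zerosPoles F R) : z - u ≠ 0 :=
      sub_ne_zero.2 fun h ↦ hzS2 (h ▸ hu)
    -- The logarithmic derivative of the factorization; the sum and g'/g are then estimated
    -- separately.
    have hld : deriv F z / F z
        = ∑ u ∈ zerosPoles F R, (D u : ℂ) * (z - u)⁻¹ + deriv g z / g z := by
      have e1 : deriv F z / F z
          = logDeriv (fun z ↦ (∏ u ∈ zerosPoles F R, (z - u) ^ D u) * g z) z := by
        rw [logDeriv_apply, hev.deriv_eq, hev.eq_of_nhds]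
      rw [e1, logDeriv_mul, logDeriv_prod_zpow hzS2, logDeriv_apply]
      · exact Finset.prod_ne_zero_iff.2 fun u hu ↦ zpow_ne_zero _ (hne u hu)
      · exact hg0 z (ball_subset_closedBall hzb)
      · exact DifferentiableAt.fun_finsetProd fun u hu ↦
          DifferentiableAt.zpow (by fun_prop) (Or.inl (hne u hu))
      · exact (hg z (ball_subset_closedBall hzb)).differentiableAt
    rw [hld]
    refine (posLog_norm_add_le _ _).trans ?_
    have b1 := posLog_norm_sum_inv_sub_le F R z
    have b2 := log_norm_deriv_div_le hg hg0 hr0.le hrR hzr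
    have b3 : 4 * R / (R - r) * circleAverage (fun ζ ↦ |log ‖g ζ‖|) 0 R
        ≤ 4 * R / (R - r) * M' := by
      apply mul_le_mul_of_nonneg_left hM
      exact div_nonneg (by linarith) (by linarith)
    simp only [K]
    linarith
  have hi : ∀ u ∈ zerosPoles F R, CircleIntegrable (fun z ↦ |log ‖z - u‖|) 0 r :=
    fun u _ ↦ (circleIntegrable_log_norm_sub u r).abs
  refine h1.trans ?_
  rw [circleAverage_fun_add (circleIntegrable_const _ _ _) hsumint, circleAverage_const,
    circleAverage_fun_sum hi]
  have h2 : ∑ u ∈ zerosPoles F R, circleAverage (fun z ↦ |log ‖z - u‖|) 0 r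
      ≤ zerosPolesCount F R * (2 * log (2 * R)) := by
    calc _ ≤ ∑ u ∈ zerosPoles F R, 2 * log (2 * R) := Finset.sum_le_sum fun u hu ↦
          circleAverage_abs_log_norm_sub_le hr hrR.le (norm_le_of_mem_zerosPoles hu)
      _ = (zerosPoles F R).card * (2 * log (2 * R)) := by simp
      _ ≤ _ := by
        gcongr
        · exact mul_nonneg zero_le_two (log_nonneg (by linarith))
        · exact card_zerosPoles_le F R
  simp only [K]
  linarith

theorem characteristic_deriv_le {F : ℂ → ℂ} (hF : Meromorphic F)
    (hF0 : ∀ z, meromorphicOrderAt F z ≠ ⊤) {r : ℝ} (hr : 1 ≤ r) :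
    characteristic (deriv F) ⊤ r ≤
      2 * characteristic F ⊤ r + proximity (fun z ↦ deriv F z / F z) ⊤ r := by
  have hFq : Meromorphic (fun z ↦ deriv F z / F z) := hF.deriv.fun_div hF
  have h1 : proximity (deriv F) ⊤ r
      ≤ proximity F ⊤ r + proximity (fun z ↦ deriv F z / F z) ⊤ r := by
    have e : deriv F =ᶠ[codiscrete ℂ] F * fun z ↦ deriv F z / F z := by
      filter_upwards [hF.meromorphicOn.eventually_codiscreteWithin_apply_ne_zero
        fun x _ ↦ hF0 x] with z hz
      rw [Pi.mul_apply, mul_div_cancel₀ _ hz]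
    rw [proximity_congr_codiscrete e (by linarith)]
    exact proximity_mul_top_le hF hFq r
  have h2 := logCounting_deriv_top_le hF hF0 hr
  have h3 : characteristic F ⊤ r = proximity F ⊤ r + logCounting F ⊤ r := rfl
  have h4 : characteristic (deriv F) ⊤ r = proximity (deriv F) ⊤ r + logCounting (deriv F) ⊤ r := rfl
  have h5 := proximity_nonneg (f := F) (a := ⊤) r
  simp only [Pi.zero_apply] at h5
  linarith

end LogarithmicDerivative

/-! ### The proximity function of the angular quotient. -/

section AngularShift

open Real Metric MeromorphicOn

theorem log_one_add_le_two_mul_sqrt {x : ℝ} (hx : 0 ≤ x) : log (1 + x) ≤ 2 * √x := by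
  have h1 : log (1 + x) ≤ log ((1 + √x) ^ 2) := by
    apply log_le_log (by positivity)
    nlinarith [sq_sqrt hx, sqrt_nonneg x]
  have h2 : log (1 + √x) ≤ √x := by
    have := log_le_sub_one_of_pos (x := 1 + √x) (by positivity)
    linarith
  rw [log_pow] at h1
  push_cast at h1
  linarith

/-- To be used with a = |z - u|, b = |z' - u|, c = |w - u|, for w on the path. Logarithms are traded
for square roots, whose singularities are harmless in the mean. If b, not a, is the distance
comparable to c, then a ≤ b + d costs the extra log(1 + d/b). -/
theorem abs_log_sub_log_le_sqrt {a b c d K : ℝ} (ha : 0 < a) (hb : 0 < b) (hc : 0 < c) (hd : 0 ≤ d)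
    (hK : 1 ≤ K) (hac : |c - a| ≤ 2 * d) (hab : a ≤ b + d) (h : a ≤ K * c ∨ b ≤ K * c) :
    |log c - log a| ≤ (2 * log K + 4) * √(d / a) + 2 * √(d / b) := by
  have hlogK : 0 ≤ log K := log_nonneg hK
  have hsb := sqrt_nonneg (d / b)
  have hsa := sqrt_nonneg (d / a)
  have h4 : √(4 * (d / a)) = 2 * √(d / a) := by
    rw [sqrt_mul (by norm_num), show (4 : ℝ) = 2 ^ 2 by norm_num, sqrt_sq (by norm_num)]
  have key {x y : ℝ} (hx : 0 < x) (hxy : x ≤ y * (1 + 4 * (d / a))) (hy : 0 < y) :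
      log x - log y ≤ 4 * √(d / a) := by
    have h1 := log_le_log hx hxy
    rw [log_mul hy.ne' (by positivity)] at h1
    have h2 := log_one_add_le_two_mul_sqrt (x := 4 * (d / a)) (by positivity)
    rw [h4] at h2
    linarith
  obtain ⟨hac1, hac2⟩ := abs_le.1 hac
  rw [abs_le]
  constructor
  -- For small d/a one has c ≥ a/2, and log(1 + 4d/a) suffices. Otherwise 2√(d/a) ≥ 1, so the
  -- constant log K can be absorbed.
  · by_cases hda : 4 * d ≤ a
    · have : a ≤ c * (1 + 4 * (d / a)) := by
        have h3 : a / 2 ≤ c := by linarith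
        have h5 : 2 * d = a / 2 * (4 * (d / a)) := by field_simp; ring
        have h6 : a / 2 * (4 * (d / a)) ≤ c * (4 * (d / a)) := by gcongr
        linarith
      have h7 := key ha this hc
      have : 0 ≤ 2 * log K * √(d / a) := by positivity
      nlinarith
    · push Not at hda
      have hs : 1 ≤ 2 * √(d / a) := by
        rw [← h4, one_le_sqrt, ← mul_div_assoc, le_div_iff₀ ha]
        linarith
      have hlog : log K ≤ 2 * log K * √(d / a) := by nlinarith
      rcases h with h | h
      · have h1 := log_le_log ha h
        rw [log_mul (by linarith) hc.ne'] at h1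
        nlinarith
      · have h1 := log_le_log hb h
        rw [log_mul (by linarith) hc.ne'] at h1
        have h2 : log a ≤ log (b * (1 + d / b)) := by
          apply log_le_log ha
          rw [mul_add, mul_div_cancel₀ _ hb.ne']
          linarith
        rw [log_mul hb.ne' (by positivity)] at h2
        have h3 := log_one_add_le_two_mul_sqrt (x := d / b) (by positivity)
        nlinarith
  · have : c ≤ a * (1 + 4 * (d / a)) := by
      rw [mul_add, mul_left_comm, mul_div_cancel₀ _ ha.ne']
      linarith
    have h7 := key hc this ha
    have : 0 ≤ 2 * log K * √(d / a) := by positivity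
    nlinarith

/-- The constant of the escape path around `N` points. -/
noncomputable def tentConst (N : ℕ) : ℝ := 16 * (2 * N + 1)

theorem one_le_tentConst (N : ℕ) : 1 ≤ tentConst N := by
  rw [tentConst]
  have : (0 : ℝ) ≤ N := N.cast_nonneg
  linarith

theorem meromorphicOrderAt_eq_zero_of_notMem_zerosPoles {F : ℂ → ℂ} (hF : Meromorphic F)
    (hF0 : ∀ z, meromorphicOrderAt F z ≠ ⊤) {R : ℝ} {w : ℂ} (hw : ‖w‖ ≤ R)
    (hwS : w ∉ zerosPoles F R) : meromorphicOrderAt F w = 0 := by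
  rw [mem_zerosPoles, not_not, divisor_apply hF.meromorphicOn (by simpa using hw),
    WithTop.untop₀_eq_zero] at hwS
  exact hwS.resolve_right (hF0 w)

/-- The increment of `f` over a short chord is controlled by the derivative at one endpoint. -/
theorem norm_sub_le_of_tent {f : ℂ → ℂ} (hf : Meromorphic f) (hfNF : ∀ z, MeromorphicNFAt f z)
    (hF0 : ∀ z, meromorphicOrderAt (deriv f) z ≠ ⊤) {r ρ R M : ℝ} {g : ℂ → ℂ}
    (hg : AnalyticOnNhd ℂ g (closedBall 0 R)) (hg0 : ∀ z ∈ closedBall (0 : ℂ) R, g z ≠ 0)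
    (hM : circleAverage (fun z ↦ |log ‖g z‖|) 0 R ≤ M)
    (hfac : ∀ z ∈ ball (0 : ℂ) R, AnalyticAt ℂ (deriv f) z → z ∉ zerosPoles (deriv f) R →
        deriv f z = (∏ u ∈ zerosPoles (deriv f) R,
          (z - u) ^ divisor (deriv f) (closedBall 0 R) u) * g z)
    (hρR : ρ < R) {z z' : ℂ} (hne : z ≠ z') (hz : ‖z‖ = r) (hz' : ‖z'‖ = r)
    {d : ℝ} (hd : ‖z' - z‖ ≤ d) (hrd : r + d ≤ ρ)
    (hzS : z ∉ zerosPoles (deriv f) R) (hzS' : z' ∉ zerosPoles (deriv f) R) :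
    ‖f z' - f z‖ ≤ 2 * d * (‖deriv f z‖ * exp (4 * R * d / (R - ρ) ^ 2 * M +
      ∑ u ∈ zerosPoles (deriv f) R, |(divisor (deriv f) (closedBall 0 R) u : ℝ)| *
        ((2 * log (tentConst (zerosPoles (deriv f) R).card) + 4) * √(d / ‖z - u‖) +
          2 * √(d / ‖z' - u‖)))) := by
  set F := deriv f with hFdef
  set S := zerosPoles F R
  set D := divisor F (closedBall 0 R)
  set K := tentConst S.card with hK
  have hF : Meromorphic F := hf.deriv
  have hd0 : 0 ≤ d := (norm_nonneg _).trans hd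
  have hr0 : 0 ≤ r := hz ▸ norm_nonneg z
  have hR0 : 0 ≤ R := by linarith
  obtain ⟨m, hm1, hm2, ht1, ht2⟩ := exists_tent S hne
  have hzu (u : ℂ) (hu : u ∈ S) : 0 < ‖z - u‖ :=
    norm_pos_iff.2 (sub_ne_zero.2 fun h ↦ hzS (h ▸ hu))
  have hzu' (u : ℂ) (hu : u ∈ S) : 0 < ‖z' - u‖ :=
    norm_pos_iff.2 (sub_ne_zero.2 fun h ↦ hzS' (h ▸ hu))
  have hK1 : 1 ≤ K := one_le_tentConst _
  -- A set containing both legs. The bound is 2d because the second leg is only known to lie within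
  -- d of z', itself within d of z.
  set T := {w : ℂ | ‖w‖ ≤ ρ ∧ ‖w - z‖ ≤ 2 * d ∧
    ∀ b ∈ S, ‖z - b‖ ≤ K * ‖w - b‖ ∨ ‖z' - b‖ ≤ K * ‖w - b‖} with hT
  have hseg {x y w : ℂ} (hw : w ∈ segment ℝ x y) : ‖w - x‖ ≤ ‖y - x‖ := norm_sub_le_of_mem_segment hw
  have hT1 : segment ℝ z m ⊆ T := by
    intro w hw
    have h1 : ‖w - z‖ ≤ d := (hseg hw).trans (hm1.trans hd)
    refine ⟨?_, by linarith, fun b hb ↦ Or.inl (by simpa [hK, tentConst] using ht1 w hw b hb)⟩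
    have := norm_le_norm_add_norm_sub z w
    rw [norm_sub_rev] at this
    linarith
  have hT2 : segment ℝ z' m ⊆ T := by
    intro w hw
    have h1 : ‖w - z'‖ ≤ d := (hseg hw).trans (hm2.trans hd)
    refine ⟨?_, ?_, fun b hb ↦ Or.inr (by simpa [hK, tentConst] using ht2 w hw b hb)⟩
    · have := norm_le_norm_add_norm_sub z' w
      rw [norm_sub_rev] at this
      linarith
    · have := norm_sub_le_norm_sub_add_norm_sub w z' z
      linarith
  have hTS (w : ℂ) (hw : w ∈ T) : w ∉ S := by
    intro hwS
    rcases hw.2.2 w hwS with h | h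
    · have := hzu w hwS
      simp at h
      exact absurd this (by rw [h]; simp)
    · have := hzu' w hwS
      simp at h
      exact absurd this (by rw [h]; simp)
  have hTan (w : ℂ) (hw : w ∈ T) : AnalyticAt ℂ f w := by
    refine (hfNF w).analyticAt_of_deriv (le_of_eq ?_)
    exact (meromorphicOrderAt_eq_zero_of_notMem_zerosPoles hF hF0 (R := R)
      (by linarith [hw.1]) (hTS w hw)).symm
  have hTR (w : ℂ) (hw : w ∈ T) : w ∈ ball (0 : ℂ) R := by
    simpa using hw.1.trans_lt hρR
  have hlog (w : ℂ) (hw : w ∈ T) : F w ≠ 0 ∧ log ‖F w‖ = ∑ u ∈ S, D u * log ‖w - u‖ + log ‖g w‖ := by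
    have hg0w := hg0 w (ball_subset_closedBall (hTR w hw))
    have hne : ∀ u ∈ S, (w - u) ^ D u ≠ 0 := fun u hu ↦
      zpow_ne_zero _ (sub_ne_zero.2 fun h ↦ hTS w hw (h ▸ hu))
    have e := hfac w (hTR w hw) (hTan w hw).deriv (hTS w hw)
    constructor
    · rw [e]
      exact mul_ne_zero (Finset.prod_ne_zero_iff.2 hne) hg0w
    · rw [e, norm_mul, norm_prod, log_mul (Finset.prod_ne_zero_iff.2 fun u hu ↦
        norm_ne_zero_iff.2 (hne u hu)) (norm_ne_zero_iff.2 hg0w),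
        log_prod fun u hu ↦ norm_ne_zero_iff.2 (hne u hu)]
      simp [norm_zpow, log_zpow]
  have hzT : z ∈ T := hT1 (left_mem_segment ℝ z m)
  set Φ := 4 * R * d / (R - ρ) ^ 2 * M + ∑ u ∈ S, |(D u : ℝ)| *
    ((2 * log K + 4) * √(d / ‖z - u‖) + 2 * √(d / ‖z' - u‖))
  have hFw (w : ℂ) (hw : w ∈ T) : ‖F w‖ ≤ ‖F z‖ * exp Φ := by
    obtain ⟨hw0, hwl⟩ := hlog w hw
    obtain ⟨hz0, hzl⟩ := hlog z hzT
    have h1 := abs_log_norm_sub_log_norm_le hg hg0 hρR hw.1 hzT.1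
    have hA : 0 ≤ circleAverage (fun z ↦ |log ‖g z‖|) 0 R :=
      circleAverage_nonneg_of_nonneg fun _ _ ↦ abs_nonneg _
    have h2 : 2 * R * ‖w - z‖ / (R - ρ) ^ 2 * circleAverage (fun z ↦ |log ‖g z‖|) 0 R
        ≤ 4 * R * d / (R - ρ) ^ 2 * M := by
      have : 2 * R * ‖w - z‖ ≤ 4 * R * d := by nlinarith [hw.2.1]
      gcongr
    have h3 : ∑ u ∈ S, D u * log ‖w - u‖ - ∑ u ∈ S, D u * log ‖z - u‖ ≤
        ∑ u ∈ S, |(D u : ℝ)| * ((2 * log K + 4) * √(d / ‖z - u‖) + 2 * √(d / ‖z' - u‖)) := by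
      rw [← Finset.sum_sub_distrib]
      refine Finset.sum_le_sum fun u hu ↦ ?_
      rw [← mul_sub]
      refine (le_abs_self _).trans ?_
      rw [abs_mul]
      gcongr
      refine abs_log_sub_log_le_sqrt (hzu u hu) (hzu' u hu)
        (norm_pos_iff.2 (sub_ne_zero.2 fun h ↦ hTS w hw (h ▸ hu))) hd0 hK1 ?_ ?_ (hw.2.2 u hu)
      · refine (abs_norm_sub_norm_le _ _).trans ?_
        simpa using hw.2.1
      · have := norm_sub_le_norm_sub_add_norm_sub z z' u
        rw [norm_sub_rev z z'] at this
        linarith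
    have h4 : log ‖F w‖ ≤ log ‖F z‖ + Φ := by
      have := (abs_le.1 h1).2
      linarith
    calc ‖F w‖ = exp (log ‖F w‖) := (exp_log (norm_pos_iff.2 hw0)).symm
      _ ≤ exp (log ‖F z‖ + Φ) := exp_le_exp.2 h4
      _ = _ := by rw [exp_add, exp_log (norm_pos_iff.2 hz0)]
  -- Mean value inequality on one leg; on both legs f' is compared with its value at z.
  have hmv {x : ℂ} (hx : segment ℝ x m ⊆ T) (hxm : ‖m - x‖ ≤ d) :
      ‖f m - f x‖ ≤ ‖F z‖ * exp Φ * d := by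
    refine ((convex_segment x m).norm_image_sub_le_of_norm_hasDerivWithin_le (f' := F)
      (fun w hw ↦ (hTan w (hx hw)).differentiableAt.hasDerivAt.hasDerivWithinAt)
      (fun w hw ↦ hFw w (hx hw)) (left_mem_segment ℝ x m) (right_mem_segment ℝ x m)).trans ?_
    gcongr
  have e1 := hmv hT1 (hm1.trans hd)
  have e2 := hmv hT2 (hm2.trans hd)
  have e3 : ‖f z' - f z‖ ≤ ‖f m - f z'‖ + ‖f m - f z‖ := by
    rw [norm_sub_rev (f m) (f z')]
    exact norm_sub_le_norm_sub_add_norm_sub _ _ _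
  linarith

theorem norm_exp_I_mul (θ : ℝ) : ‖Complex.exp (Complex.I * θ)‖ = 1 := by
  rw [mul_comm, Complex.norm_exp_ofReal_mul_I]

theorem norm_exp_I_mul_sub_one_le (θ : ℝ) : ‖Complex.exp (Complex.I * θ) - 1‖ ≤ |θ| := by
  simpa using Real.norm_exp_I_mul_ofReal_sub_one_le (x := θ)

theorem meromorphic_angularQuotient {f : ℂ → ℂ} (hf : Meromorphic f) (θ : ℝ) :
    Meromorphic (angularQuotient f θ) := by
  have h1 : Meromorphic fun z ↦ f (Complex.exp (Complex.I * θ) * z) := by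
    intro z
    refine MeromorphicAt.comp_analyticAt (f := f) (hf _) (by fun_prop)
  exact (h1.fun_sub hf).fun_div hf.deriv

/-- Average the pointwise bound of `norm_sub_le_of_tent`. The singularities at u, and at e⁻¹u coming
from z' = ez, have the same mean bound: √d times `invSqrtConst`/√r, which is `invSqrtConst` · √θ
since d = θr. -/
theorem proximity_angularQuotient_le {f : ℂ → ℂ} (hf : Meromorphic f)
    (hfNF : ∀ z, MeromorphicNFAt f z) (hF0 : ∀ z, meromorphicOrderAt (deriv f) z ≠ ⊤)
    {r ρ R θ : ℝ} (hr : 1 ≤ r) (hρR : ρ < R) (hθ : 0 ≤ θ) (hrθ : r + θ * r ≤ ρ) :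
    proximity (angularQuotient f θ) ⊤ r ≤
      log⁺ (2 * (θ * r)) + 4 * R * (θ * r) / (R - ρ) ^ 2 *
        (2 * characteristic (deriv f) ⊤ R + fmtConst (deriv f) +
          zerosPolesCount (deriv f) R * (2 * log (2 * R))) +
      zerosPolesCount (deriv f) R *
        ((2 * log (tentConst (zerosPoles (deriv f) R).card) + 6) * (invSqrtConst * √θ)) := by
  have hr0 : 0 < r := by linarith
  set d := θ * r with hd
  have hd0 : 0 ≤ d := by positivity
  have hR : 1 ≤ R := by linarith
  have hF := hf.deriv
  obtain ⟨g, hg, hg0, hM, hfac⟩ := exists_factorization hF hF0 hR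
  set M := 2 * characteristic (deriv f) ⊤ R + fmtConst (deriv f) +
          zerosPolesCount (deriv f) R * (2 * log (2 * R))
  set S := zerosPoles (deriv f) R with hS
  set D := divisor (deriv f) (closedBall 0 R)
  set e := Complex.exp (Complex.I * θ) with he
  have hnorm_e : ‖e‖ = 1 := norm_exp_I_mul θ
  have he0 : e ≠ 0 := Complex.exp_ne_zero _
  set L := 2 * log (tentConst S.card) + 4 with hL
  have hL0 : 0 ≤ L := by
    have := log_nonneg (one_le_tentConst S.card)
    linarith
  set κ := log⁺ (2 * d) + 4 * R * d / (R - ρ) ^ 2 * M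
  set φ : ℂ → ℂ → ℝ := fun u z ↦ (|(D u : ℝ)| * (L * √d)) • (1 / √‖z - u‖) +
    (|(D u : ℝ)| * (2 * √d)) • (1 / √‖z - e⁻¹ * u‖) with hφ
  have hI (c : ℝ) (u : ℂ) : CircleIntegrable (fun z ↦ c • (1 / √‖z - u‖)) 0 r :=
    (circleIntegrable_inv_sqrt_norm_sub hr0 u).const_smul (a := c)
  have hφint : ∀ u ∈ S, CircleIntegrable (φ u) 0 r := fun u _ ↦ (hI _ _).add (hI _ _)
  have hφsum : CircleIntegrable (fun z ↦ ∑ u ∈ S, φ u z) 0 r := by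
    have := CircleIntegrable.sum (c := 0) (R := r) S (f := φ) hφint
    convert! this using 1
    ext z
    simp
  have hpt : proximity (angularQuotient f θ) ⊤ r ≤
      circleAverage (fun z ↦ κ + ∑ u ∈ S, φ u z) 0 r := by
    rw [proximity_top]
    have hSc : ((S : Set ℂ) ∪ (fun z ↦ e * z) ⁻¹' S).Countable :=
      (S.finite_toSet.union (S.finite_toSet.preimage
        (mul_right_injective₀ he0).injOn)).countable
    refine circleAverage_mono_of_countable hr0.ne' hSc
      (meromorphic_angularQuotient hf θ).meromorphicOn.circleIntegrable_posLog_norm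
      ((circleIntegrable_const _ _ _).add hφsum) ?_
    intro z hz hzS
    rw [Set.mem_union, not_or] at hzS
    have hzr : ‖z‖ = r := by simpa [abs_of_pos hr0] using hz
    have hzr' : ‖e * z‖ = r := by rw [norm_mul, hnorm_e, one_mul, hzr]
    have hφ0 : 0 ≤ ∑ u ∈ S, φ u z := Finset.sum_nonneg fun u _ ↦ by
      simp only [hφ, smul_eq_mul]
      positivity
    have hM0 : 0 ≤ M := (circleAverage_nonneg_of_nonneg fun _ _ ↦ abs_nonneg _).trans hM
    have hq0 : 0 ≤ 4 * R * d / (R - ρ) ^ 2 * M := by positivity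
    have hbase : angularQuotient f θ z = (f (e * z) - f z) / deriv f z := rfl
    rw [hbase]
    have hdz : ‖e * z - z‖ ≤ d := by
      rw [show e * z - z = (e - 1) * z by ring, norm_mul, hzr, hd]
      gcongr
      exact (norm_exp_I_mul_sub_one_le θ).trans_eq (abs_of_nonneg hθ)
    -- If the rotation is trivial there is no path to build, but the quotient vanishes.
    rcases eq_or_ne z (e * z) with hee | hee
    · rw [← hee]
      simp only [sub_self, zero_div, norm_zero, posLog_zero]
      have : 0 ≤ log⁺ (2 * d) := posLog_nonneg
      positivity
    · have h1 := norm_sub_le_of_tent hf hfNF hF0 hg hg0 hM hfac hρR hee hzr hzr' hdz hrθ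
        hzS.1 hzS.2
      set Ψ := 4 * R * d / (R - ρ) ^ 2 * M + ∑ u ∈ S, |(D u : ℝ)| *
        (L * √(d / ‖z - u‖) + 2 * √(d / ‖e * z - u‖))
      have hΨ : Ψ = 4 * R * d / (R - ρ) ^ 2 * M + ∑ u ∈ S, φ u z := by
        simp only [Ψ, hφ]
        congr 1
        refine Finset.sum_congr rfl fun u _ ↦ ?_
        have : ‖e * z - u‖ = ‖z - e⁻¹ * u‖ := by
          rw [show e * z - u = e * (z - e⁻¹ * u) by field_simp, norm_mul, hnorm_e, one_mul]
        rw [this, sqrt_div hd0, sqrt_div hd0, smul_eq_mul, smul_eq_mul]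
        ring
      have h2 : ‖(f (e * z) - f z) / deriv f z‖ ≤ 2 * d * exp Ψ := by
        rw [norm_div]
        refine div_le_of_le_mul₀ (norm_nonneg _) (by positivity) (h1.trans (le_of_eq ?_))
        ring
      have hΨ0 : 0 ≤ Ψ := by rw [hΨ]; positivity
      refine (posLog_le_posLog (norm_nonneg _) h2).trans (posLog_mul.trans ?_)
      rw [posLog_eq_log (x := exp Ψ) (by rw [abs_of_pos (exp_pos _)]; exact one_le_exp hΨ0),
        log_exp, hΨ]
      simp only [κ]
      linarith
  refine hpt.trans ?_
  rw [circleAverage_fun_add (circleIntegrable_const _ _ _) hφsum, circleAverage_const,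
    circleAverage_fun_sum hφint]
  gcongr
  rw [zerosPolesCount, Finset.sum_mul]
  refine Finset.sum_le_sum fun u _ ↦ ?_
  simp only [hφ]
  rw [circleAverage_fun_add (hI _ _) (hI _ _), circleAverage_fun_smul, circleAverage_fun_smul,
    smul_eq_mul, smul_eq_mul]
  have hsd : √d = √θ * √r := by rw [hd, sqrt_mul hθ]
  have hsr : 0 < √r := sqrt_pos.2 hr0
  have h1 (u : ℂ) : √d * circleAverage (fun z ↦ 1 / √‖z - u‖) 0 r ≤ invSqrtConst * √θ := by
    have := mul_le_mul_of_nonneg_left (circleAverage_inv_sqrt_norm_sub_le hr0 u) (sqrt_nonneg d)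
    refine this.trans (le_of_eq ?_)
    rw [hsd]
    field_simp
  calc _ = |(D u : ℝ)| * (L * (√d * circleAverage (fun z ↦ 1 / √‖z - u‖) 0 r) +
        2 * (√d * circleAverage (fun z ↦ 1 / √‖z - e⁻¹ * u‖) 0 r)) := by ring
    _ ≤ |(D u : ℝ)| * (L * (invSqrtConst * √θ) + 2 * (invSqrtConst * √θ)) := by
      exact mul_le_mul_of_nonneg_left (add_le_add (mul_le_mul_of_nonneg_left (h1 u) hL0)
        (mul_le_mul_of_nonneg_left (h1 _) zero_le_two)) (abs_nonneg _)
    _ = _ := by rw [hL]; ring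

end AngularShift

/-! ### Logarithmic growth of T and rational functions. -/

section Growth

open Real Metric MeromorphicOn

/-- Divide n(R) log(r/R) ≤ 2T(r) + O(1) by log r and let r → ∞ along the given radii. -/
theorem zerosPolesCount_le_of_frequently {f : ℂ → ℂ} (hf : Meromorphic f) {C : ℝ}
    (h : ∃ᶠ r in atTop, characteristic f ⊤ r ≤ C * log r) {R : ℝ} (hR : 1 ≤ R) :
    zerosPolesCount f R ≤ 2 * C := by
  by_contra! hlt
  set n := zerosPolesCount f R
  have h1 : ∀ᶠ r in atTop, n * log R + fmtConst f < (n - 2 * C) * log r :=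
    (tendsto_log_atTop.const_mul_atTop (sub_pos.2 hlt)).eventually_gt_atTop _
  obtain ⟨r, hr, h2, h3⟩ := (h.and_eventually (h1.and (eventually_ge_atTop R))).exists
  have h4 := zerosPolesCount_mul_log_le hf hR h3
  rw [log_div (by linarith) (by linarith)] at h4
  change n * _ ≤ _ at h4
  linarith

theorem finite_support_divisor_of_frequently {f : ℂ → ℂ} (hf : Meromorphic f) {C : ℝ}
    (h : ∃ᶠ r in atTop, characteristic f ⊤ r ≤ C * log r) :
    (divisor f Set.univ).support.Finite := by
  by_contra hinf
  obtain ⟨N, hN⟩ := exists_nat_gt (2 * C)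
  obtain ⟨A, hA, hcard⟩ := Set.Infinite.exists_subset_card_eq hinf N
  obtain ⟨R, hR⟩ : ∃ R : ℝ, ∀ u ∈ A, ‖u‖ ≤ R :=
    (A.finite_toSet.isBounded.exists_norm_le)
  have hsub : A ⊆ zerosPoles f (max R 1) := by
    intro u hu
    rw [mem_zerosPoles, divisor_closedBall_eq_univ hf ((hR u hu).trans (le_max_left _ _))]
    exact hA hu
  have h1 := zerosPolesCount_le_of_frequently hf h (le_max_right R 1)
  have h2 := card_zerosPoles_le f (max R 1)
  have h3 : (A.card : ℝ) ≤ (zerosPoles f (max R 1)).card := by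
    exact_mod_cast Finset.card_le_card hsub
  rw [hcard] at h3
  linarith

theorem tendsto_mul_log_div_sq (a b c : ℝ) :
    Tendsto (fun R : ℝ ↦ R * a / (R - b) ^ 2 * (c + c * log R)) atTop (𝓝 0) := by
  have h1 : Tendsto (fun R : ℝ ↦ (c + c * log R) / R) atTop (𝓝 0) := by
    have e1 : Tendsto (fun R : ℝ ↦ c * (1 / R) + c * (log R / R)) atTop (𝓝 (c * 0 + c * 0)) := by
      refine Tendsto.add (Tendsto.const_mul _ ?_) (Tendsto.const_mul _ ?_)
      · exact (tendsto_inv_atTop_zero (𝕜 := ℝ)).congr fun x ↦ (one_div x).symm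
      · exact isLittleO_log_id_atTop.tendsto_div_nhds_zero
    rw [mul_zero, add_zero] at e1
    refine e1.congr fun R ↦ ?_
    ring
  have h2 : Tendsto (fun R : ℝ ↦ (1 - b / R)⁻¹ ^ 2) atTop (𝓝 ((1 - 0)⁻¹ ^ 2)) := by
    have : Tendsto (fun R : ℝ ↦ b / R) atTop (𝓝 0) := tendsto_const_nhds.div_atTop tendsto_id
    exact ((tendsto_const_nhds.sub this).inv₀ (by norm_num)).pow 2
  have h3 := (h2.mul h1).const_mul a
  rw [mul_zero, mul_zero] at h3
  refine h3.congr' ?_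
  filter_upwards [eventually_gt_atTop 0, eventually_gt_atTop b] with R hR hb
  have : R - b ≠ 0 := by linarith
  have e : 1 - b / R = (R - b) / R := by field_simp
  rw [e]
  field_simp

/-- The Poisson estimate between w and 0 is O(log R / R), so |g| is constant and Liouville's theorem
applies. -/
theorem exists_const_of_frequently {g : ℂ → ℂ} (hg : AnalyticOnNhd ℂ g Set.univ)
    (hg0 : ∀ z, g z ≠ 0) {c : ℝ}
    (h : ∃ᶠ r in atTop, circleAverage (fun z ↦ |log ‖g z‖|) 0 r ≤ c + c * log r) (z : ℂ) :
    g z = g 0 := by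
  have hnorm (w : ℂ) : ‖g w‖ ≤ ‖g 0‖ := by
    have hle : |log ‖g w‖ - log ‖g 0‖| ≤ 0 := by
      have ht := tendsto_mul_log_div_sq (2 * ‖w - 0‖) ‖w‖ c
      refine ge_of_tendsto_of_frequently ht ?_
      refine (h.and_eventually (eventually_gt_atTop ‖w‖)).mono fun R hR ↦ ?_
      refine (abs_log_norm_sub_log_norm_le (hg.mono (Set.subset_univ _)) (fun z _ ↦ hg0 z)
        hR.2 le_rfl (z := 0) (by simp)).trans ?_
      have hR0 : 0 ≤ R := (norm_nonneg w).trans hR.2.le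
      rw [show R * (2 * ‖w - 0‖) = 2 * R * ‖w - 0‖ by ring]
      gcongr
      exact hR.1
    have h1 := sub_eq_zero.1 (abs_eq_zero.1 (le_antisymm hle (abs_nonneg _)))
    exact (log_injOn_pos (norm_pos_iff.2 (hg0 w)) (norm_pos_iff.2 (hg0 0)) h1).le
  have hdiff : Differentiable ℂ g := fun z ↦ (hg z (Set.mem_univ z)).differentiableAt
  refine hdiff.apply_eq_apply_of_bounded ?_ z 0
  refine isBounded_iff_forall_norm_le.2 ⟨‖g 0‖, ?_⟩
  rintro _ ⟨w, rfl⟩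
  exact hnorm w

/-- A meromorphic function of at most logarithmic growth is a product of linear factors. -/
theorem exists_eq_prod_of_frequently {f : ℂ → ℂ} (hf : Meromorphic f)
    (hf0 : ∀ z, meromorphicOrderAt f z ≠ ⊤) {C : ℝ}
    (h : ∃ᶠ r in atTop, characteristic f ⊤ r ≤ C * log r) :
    ∃ (S : Finset ℂ) (c : ℂ), (∀ u ∈ S, divisor f Set.univ u ≠ 0) ∧
      f =ᶠ[codiscrete ℂ] fun z ↦ (∏ u ∈ S, (z - u) ^ divisor f Set.univ u) * c := by
  have hfin := finite_support_divisor_of_frequently hf h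
  obtain ⟨g, hg, hg0, hfg⟩ := MeromorphicOn.extract_zeros_poles (U := Set.univ)
    hf.meromorphicOn (fun u ↦ hf0 u) hfin
  have hg0' (z : ℂ) : g z ≠ 0 := hg0 ⟨z, Set.mem_univ z⟩
  set S := hfin.toFinset
  rw [finprod_sub_zpow_eq (S := S) (by simp [S])] at hfg
  set D := divisor f Set.univ
  obtain ⟨ρ, hρ⟩ : ∃ R : ℝ, ∀ u ∈ S, ‖u‖ ≤ R := S.finite_toSet.isBounded.exists_norm_le
  set n := ∑ u ∈ S, |(D u : ℝ)|
  have hn : 0 ≤ n := Finset.sum_nonneg fun _ _ ↦ abs_nonneg _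
  have hfq : ∃ᶠ r in atTop, circleAverage (fun z ↦ |log ‖g z‖|) 0 r ≤
      (2 * |C| + fmtConst f + 2 * n) + (2 * |C| + fmtConst f + 2 * n) * log r := by
    refine (h.and_eventually ((eventually_ge_atTop ρ).and (eventually_ge_atTop 1))).mono ?_
    rintro r ⟨h1, h2, h3⟩
    have h4 := circleAverage_abs_log_norm_factor_le hf h3 (hg.mono (Set.subset_univ _))
      (fun z _ ↦ hg0' z) (S := S) (D := D) (fun u hu ↦ (hρ u hu).trans h2)
      (hfg.filter_mono (codiscreteWithin_mono (Set.subset_univ _)))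
    have h5 : log (2 * r) ≤ 1 + log r := by
      rw [log_mul two_ne_zero (by linarith)]
      linarith [log_two_lt_d9]
    have h6 : 0 ≤ log r := log_nonneg h3
    have h7 : C * log r ≤ |C| * log r := by gcongr; exact le_abs_self C
    have h8 := mul_le_mul_of_nonneg_left h5 hn
    have h9 := mul_nonneg (fmtConst_nonneg f) h6
    have := abs_nonneg C
    change _ ≤ _ + n * _ at h4
    nlinarith
  refine ⟨S, g 0, fun u hu ↦ by simpa [S] using hu, ?_⟩
  filter_upwards [hfg] with z hz
  rw [hz]
  simp only [Pi.smul_apply', smul_eq_mul]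
  rw [exists_const_of_frequently hg hg0' hfq z]

theorem isRationalMero_of_eq_prod {f : ℂ → ℂ} {S : Finset ℂ} {D : ℂ → ℤ} {c : ℂ}
    (h : f =ᶠ[codiscrete ℂ] fun z ↦ (∏ u ∈ S, (z - u) ^ D u) * c) : IsRationalMero f := by
  refine ⟨(∏ u ∈ S, (Polynomial.X - Polynomial.C u) ^ (D u).toNat) * Polynomial.C c,
    ∏ u ∈ S, (Polynomial.X - Polynomial.C u) ^ (-D u).toNat,
    Finset.prod_ne_zero_iff.2 fun u _ ↦ pow_ne_zero _ (Polynomial.X_sub_C_ne_zero u), ?_⟩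
  have hS : (S : Set ℂ)ᶜ ∈ codiscrete ℂ := S.finite_toSet.compl_mem_codiscrete
  filter_upwards [h, hS] with z hz hzS
  rw [hz]
  simp only [Polynomial.eval_mul, Polynomial.eval_prod, Polynomial.eval_pow, Polynomial.eval_sub,
    Polynomial.eval_X, Polynomial.eval_C]
  rw [mul_div_right_comm, ← Finset.prod_div_distrib]
  congr 1
  refine Finset.prod_congr rfl fun u hu ↦ ?_
  have hne : z - u ≠ 0 := sub_ne_zero.2 fun h ↦ hzS (h ▸ hu)
  rw [← zpow_natCast, ← zpow_natCast, ← zpow_sub₀ hne, Int.toNat_sub_toNat_neg]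

/-- If T ≤ (log r)/3 at arbitrarily large radii, the number of zeros and poles is at most 2/3, hence
zero, and the product formula leaves a constant. -/
theorem eventually_log_le_characteristic {f : ℂ → ℂ} (hf : Meromorphic f)
    (hc : ¬ IsConstantMero f) : ∀ᶠ r in atTop, log r ≤ 3 * characteristic f ⊤ r := by
  by_contra hcon
  have hfr : ∃ᶠ r in atTop, characteristic f ⊤ r ≤ 1 / 3 * log r := by
    refine (not_eventually.1 hcon).mono fun r hr ↦ ?_
    linarith
  have hf0 := meromorphicOrderAt_ne_top_of_not_isConstantMero hf hc
  obtain ⟨S, c, hS, hfS⟩ := exists_eq_prod_of_frequently hf hf0 hfr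
  have hS0 : S = ∅ := by
    rw [Finset.eq_empty_iff_forall_notMem]
    intro u hu
    have h1 := zerosPolesCount_le_of_frequently hf hfr (le_max_right ‖u‖ 1)
    have h2 : u ∈ zerosPoles f (max ‖u‖ 1) := by
      rw [mem_zerosPoles, divisor_closedBall_eq_univ hf (le_max_left _ _)]
      exact hS u hu
    have h3 := card_zerosPoles_le f (max ‖u‖ 1)
    have h4 : (1 : ℝ) ≤ (zerosPoles f (max ‖u‖ 1)).card := by
      exact_mod_cast Finset.card_pos.2 ⟨u, h2⟩
    linarith
  exact hc ⟨c, by simpa [hS0] using hfS⟩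

theorem isLittleO_log_characteristic {f : ℂ → ℂ} (hf : Meromorphic f)
    (hc : ¬ IsConstantMero f) (hr : ¬ IsRationalMero f) : log =o[atTop] characteristic f ⊤ := by
  refine Asymptotics.isLittleO_iff.2 fun c hc0 ↦ ?_
  by_contra hcon
  have hf0 := meromorphicOrderAt_ne_top_of_not_isConstantMero hf hc
  have hfr : ∃ᶠ r in atTop, characteristic f ⊤ r ≤ c⁻¹ * log r := by
    refine ((not_eventually.1 hcon).and_eventually (eventually_ge_atTop 1)).mono fun r hr ↦ ?_
    have h1 := not_le.1 hr.1
    rw [norm_of_nonneg (log_nonneg hr.2)] at h1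
    rw [inv_mul_eq_div, le_div_iff₀' hc0]
    exact (mul_le_mul_of_nonneg_left (le_abs_self _) hc0.le).trans h1.le
  obtain ⟨S, c', hS, hfS⟩ := exists_eq_prod_of_frequently hf hf0 hfr
  exact hr (isRationalMero_of_eq_prod hfS)

end Growth

/-! ### Borel's lemma with an exceptional set of finite logarithmic measure. -/

section BorelGrowth

open Real

theorem lintegral_inv_Icc_le {a x : ℝ} (ha : 0 < a) :
    ∫⁻ t in Set.Icc a (a * (1 + x)), ENNReal.ofReal (1 / t) ≤ ENNReal.ofReal x := by
  calc _ ≤ ∫⁻ _ in Set.Icc a (a * (1 + x)), ENNReal.ofReal (1 / a) := by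
        refine setLIntegral_mono' measurableSet_Icc fun t ht ↦ ?_
        exact ENNReal.ofReal_le_ofReal (one_div_le_one_div_of_le ha ht.1)
    _ = ENNReal.ofReal (1 / a) * ENNReal.ofReal (a * x) := by
        rw [setLIntegral_const, Real.volume_Icc]
        congr 2
        ring
    _ = ENNReal.ofReal x := by
        rw [← ENNReal.ofReal_mul (by positivity)]
        congr 1
        field_simp

theorem finiteLogMeasure_iUnion_Icc {a : ℕ → ℝ} (ha : ∀ k, 0 < a k) {q : ℝ} (hq0 : 0 ≤ q)
    (hq1 : q < 1) : FiniteLogMeasure (⋃ k, Set.Icc (a k) (a k * (1 + q ^ k))) := by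
  refine ⟨MeasurableSet.iUnion fun _ ↦ measurableSet_Icc,
    Set.iUnion_subset fun k t ht ↦ (ha k).trans_le ht.1, ?_⟩
  refine (lintegral_iUnion_le _ _).trans_lt ?_
  refine (ENNReal.tsum_le_tsum fun k ↦ lintegral_inv_Icc_le (ha k)).trans_lt ?_
  rw [← ENNReal.ofReal_tsum_of_nonneg (fun k ↦ pow_nonneg hq0 k)
    (summable_geometric_of_lt_one hq0 hq1)]
  exact ENNReal.ofReal_lt_top

/-- Borel's growth lemma. -/
theorem exists_finiteLogMeasure_growth {T : ℝ → ℝ} (hmono : MonotoneOn T (Set.Ioi 0))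
    (htop : Tendsto T atTop atTop) {δ : ℝ} (hδ : 0 < δ) :
    ∃ E, FiniteLogMeasure E ∧
      ∀ᶠ r in atTop ⊓ 𝓟 Eᶜ, T (r * (1 + T r ^ (-δ))) ≤ 2 * T r := by
  set q : ℝ := 2 ^ (-δ) with hq
  have hq0 : 0 < q := by positivity
  have hq1 : q < 1 := rpow_lt_one_of_one_lt_of_neg (by norm_num) (by linarith)
  -- The bad radii are sorted by the dyadic size of T. For x and r in `B k`, T(r) < 2^{k+1} ≤ 2T(x)
  -- < T(x(1 + T(x)^{-δ})), so r < x(1 + q^k) by monotonicity. Thus `B k` has logarithmic measure at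
  -- most q^k, which is summable.
  set B : ℕ → Set ℝ := fun k ↦ {r | 1 ≤ r ∧ 2 ^ k ≤ T r ∧ T r < 2 ^ (k + 1) ∧
    2 * T r < T (r * (1 + T r ^ (-δ)))}
  -- The maximum with 1 keeps `a k` positive when `B k` is empty, where `sInf` is 0.
  set a : ℕ → ℝ := fun k ↦ max 1 (sInf (B k))
  have ha (k : ℕ) : 0 < a k := lt_max_of_lt_left one_pos
  have hBa (k : ℕ) : B k ⊆ Set.Icc (a k) (a k * (1 + q ^ k)) := by
    intro r hr
    have hbdd : BddBelow (B k) := ⟨1, fun x hx ↦ hx.1⟩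
    refine ⟨max_le hr.1 (csInf_le hbdd hr), ?_⟩
    have hpos : 0 < 1 + q ^ k := by positivity
    have hlow : r / (1 + q ^ k) ≤ sInf (B k) := by
      refine le_csInf ⟨r, hr⟩ fun x hx ↦ ?_
      obtain ⟨hx1, hx2, hx3, hx4⟩ := hx
      have hxT : 0 < T x := (by positivity : (0 : ℝ) < 2 ^ k).trans_le hx2
      have hxpow : T x ^ (-δ) ≤ q ^ k := by
        calc T x ^ (-δ) ≤ ((2 : ℝ) ^ k) ^ (-δ) :=
              rpow_le_rpow_of_nonpos (by positivity) hx2 (by linarith)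
          _ = q ^ k := by
              rw [hq, ← rpow_natCast, ← rpow_natCast, ← rpow_mul (by norm_num),
                ← rpow_mul (by norm_num), mul_comm]
      have hx0 : 0 < x := by linarith
      have hlt : r < x * (1 + T x ^ (-δ)) := by
        by_contra! hle
        have hpos' : 0 < x * (1 + T x ^ (-δ)) := by positivity
        have h1 := hmono hpos' (hpos'.trans_le hle) hle
        have h2 := hr.2.2.1
        rw [pow_succ] at h2
        linarith
      rw [div_le_iff₀ hpos]
      exact hlt.le.trans (by gcongr)
    rw [div_le_iff₀ hpos] at hlow
    exact hlow.trans (by gcongr; exact le_max_right _ _)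
  refine ⟨_, finiteLogMeasure_iUnion_Icc ha hq0.le hq1, ?_⟩
  rw [eventually_inf_principal]
  filter_upwards [eventually_ge_atTop 1, htop.eventually_ge_atTop 1] with r hr hTr hrE
  by_contra! hbad
  obtain ⟨k, hk1, hk2⟩ := exists_nat_pow_near hTr (one_lt_two (α := ℝ))
  exact hrE (Set.mem_iUnion.2 ⟨k, hBa k ⟨hr, hk1, hk2, hbad⟩⟩)

end BorelGrowth

/-! ### Explicit bounds along the radii r(1 + jτ). -/

section ErrorTerm

open Real Metric MeromorphicOn

/-- The radius 1 + 4τ serves to count zeros and poles up to 1 + 3τ, and 1 + 3τ to estimate f'/f at 1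
+ 2τ. Each passage costs a factor 1/τ. -/
theorem characteristic_deriv_le_of_growth {f : ℂ → ℂ} (hf : Meromorphic f)
    (hf0 : ∀ z, meromorphicOrderAt f z ≠ ⊤) {r X τ : ℝ} (hr : 2 ≤ r) (hL : 1 ≤ log r)
    (hX : 1 ≤ X) (hcX : fmtConst f ≤ X) (hτ0 : 0 < τ) (hτ : τ ≤ 1 / 4)
    (hT : characteristic f ⊤ (r * (1 + 4 * τ)) ≤ 2 * X) :
    characteristic (deriv f) ⊤ (r * (1 + 2 * τ)) ≤ 610 * (X * log r / τ ^ 2) := by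
  have hr0 : 0 < r := by linarith
  have hrτ : 0 < r * τ := by positivity
  set L := log r
  have hmono := characteristic_monotoneOn hf
  have hpos (j : ℝ) (hj : 0 ≤ j) : (0 : ℝ) < r * (1 + j * τ) := by positivity
  have hT3 : characteristic f ⊤ (r * (1 + 3 * τ)) ≤ 2 * X :=
    (hmono (hpos 3 (by norm_num)) (hpos 4 (by norm_num)) (by nlinarith)).trans hT
  have hT2 : characteristic f ⊤ (r * (1 + 2 * τ)) ≤ 2 * X :=
    (hmono (hpos 2 (by norm_num)) (hpos 4 (by norm_num)) (by nlinarith)).trans hT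
  have hlog : log (2 * (r * (1 + 3 * τ))) ≤ 3 * L := by
    rw [show 3 * L = log (r ^ 3) by rw [log_pow]; norm_num; rfl]
    apply log_le_log (by positivity)
    nlinarith [mul_nonneg hr0.le (sub_nonneg.2 hr),
      mul_nonneg (mul_nonneg hr0.le hr0.le) (sub_nonneg.2 hr)]
  have hlog0 : 0 ≤ log (2 * (r * (1 + 3 * τ))) := log_nonneg (by nlinarith)
  set n := zerosPolesCount f (r * (1 + 3 * τ))
  have hn0 : 0 ≤ n := zerosPolesCount_nonneg _ _
  have hn : n ≤ 10 * (X / τ) := by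
    have h1 := zerosPolesCount_le hf (R := r * (1 + 3 * τ)) (R' := r * (1 + 4 * τ))
      (by nlinarith) (by nlinarith)
    refine h1.trans ?_
    have h2 : r * (1 + 4 * τ) / (r * (1 + 4 * τ) - r * (1 + 3 * τ)) ≤ 2 / τ := by
      rw [show r * (1 + 4 * τ) - r * (1 + 3 * τ) = r * τ by ring, div_le_div_iff₀ hrτ hτ0]
      nlinarith
    calc _ ≤ (2 * (2 * X) + X) * (2 / τ) := by
          apply mul_le_mul (by linarith) h2 _ (by linarith)
          rw [show r * (1 + 4 * τ) - r * (1 + 3 * τ) = r * τ by ring]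
          exact div_nonneg (hpos 4 (by norm_num)).le hrτ.le
      _ = _ := by ring
  have hm := proximity_logDeriv_le hf hf0 (r := r * (1 + 2 * τ)) (R := r * (1 + 3 * τ))
    (by nlinarith) (by nlinarith)
  have hc := characteristic_deriv_le hf hf0 (r := r * (1 + 2 * τ)) (by nlinarith)
  have e : r * (1 + 3 * τ) - r * (1 + 2 * τ) = r * τ := by ring
  rw [e] at hm
  set Y := X * L / τ ^ 2 with hY
  have hXτ : X / τ ≤ Y := by
    rw [hY, div_le_div_iff₀ hτ0 (by positivity)]
    have h1 : τ ≤ L := by linarith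
    calc X * τ ^ 2 = (X * τ) * τ := by ring
      _ ≤ (X * τ) * L := by gcongr
      _ = _ := by ring
  have hXLτ : X * L / τ ≤ Y := by
    rw [hY]
    gcongr
    nlinarith
  have hXY : X ≤ Y := by
    refine le_trans ?_ hXτ
    rw [le_div_iff₀ hτ0]
    nlinarith
  have hnL : n * (2 * log (2 * (r * (1 + 3 * τ)))) ≤ 60 * (X * L / τ) := by
    calc _ ≤ 10 * (X / τ) * (2 * (3 * L)) := by gcongr
      _ = _ := by ring
  have hXL : X ≤ X * L / τ := by
    rw [le_div_iff₀ hτ0]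
    nlinarith
  have hM : 4 * (r * (1 + 3 * τ)) / (r * τ) * (2 * characteristic f ⊤ (r * (1 + 3 * τ)) +
      fmtConst f + n * (2 * log (2 * (r * (1 + 3 * τ))))) ≤ 520 * Y := by
    have h1 : 4 * (r * (1 + 3 * τ)) / (r * τ) ≤ 8 / τ := by
      rw [div_le_div_iff₀ hrτ hτ0]
      nlinarith
    have h3 : 2 * characteristic f ⊤ (r * (1 + 3 * τ)) + fmtConst f +
        n * (2 * log (2 * (r * (1 + 3 * τ)))) ≤ 65 * (X * L / τ) := by linarith
    calc _ ≤ 4 * (r * (1 + 3 * τ)) / (r * τ) * (65 * (X * L / τ)) := by gcongr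
      _ ≤ 8 / τ * (65 * (X * L / τ)) := by gcongr
      _ = _ := by rw [hY]; field_simp; norm_num
  have hlp : log⁺ (2 / (r * τ)) ≤ Y := by
    have h1 : 2 / (r * τ) ≤ X / τ := by
      rw [div_le_div_iff₀ hrτ hτ0]
      have : 2 * τ ≤ r * τ := by gcongr
      nlinarith
    refine le_trans ?_ (h1.trans hXτ)
    rw [posLog_apply]
    exact max_le (by positivity) (log_le_self (by positivity))
  have hlog2 : log 2 ≤ Y := by linarith [log_two_lt_d9]
  linarith

theorem zerosPolesCount_deriv_le_of_growth {f : ℂ → ℂ} (hf : Meromorphic f)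
    {r X τ : ℝ} (hr : 2 ≤ r) (hL : 1 ≤ log r)
    (hX : 1 ≤ X) (hcX : fmtConst (deriv f) ≤ X) (hτ0 : 0 < τ) (hτ : τ ≤ 1 / 4)
    (hT : characteristic (deriv f) ⊤ (r * (1 + 2 * τ)) ≤ 610 * (X * log r / τ ^ 2)) :
    zerosPolesCount (deriv f) (r * (1 + τ)) ≤ 2442 * (X * log r / τ ^ 3) := by
  have hr0 : 0 < r := by linarith
  have hrτ : 0 < r * τ := by positivity
  set L := log r
  have hXY : X ≤ X * L / τ ^ 2 := by
    rw [le_div_iff₀ (by positivity)]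
    have : τ ^ 2 ≤ L := by nlinarith
    gcongr
  have h1 := zerosPolesCount_le hf.deriv (R := r * (1 + τ)) (R' := r * (1 + 2 * τ))
    (by nlinarith) (by nlinarith)
  refine h1.trans ?_
  rw [show r * (1 + 2 * τ) - r * (1 + τ) = r * τ by ring]
  have h2 : r * (1 + 2 * τ) / (r * τ) ≤ 2 / τ := by
    rw [div_le_div_iff₀ hrτ hτ0]
    nlinarith
  calc _ ≤ (1221 * (X * L / τ ^ 2)) * (2 / τ) := by
        apply mul_le_mul (by linarith) h2 (by positivity) (by positivity)
    _ = _ := by field_simp; norm_num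

theorem proximity_angularQuotient_le_of_growth {f : ℂ → ℂ} (hf : Meromorphic f)
    (hfNF : ∀ z, MeromorphicNFAt f z) (hc : ¬ IsConstantMero f) {r X τ θ : ℝ} (hr : 2 ≤ r)
    (hL : 1 ≤ log r) (hX : 1 ≤ X) (hcX : fmtConst f ≤ X) (hcX' : fmtConst (deriv f) ≤ X)
    (hτ0 : 0 < τ) (hτ : τ ≤ 1 / 4) (hT : characteristic f ⊤ (r * (1 + 4 * τ)) ≤ 2 * X)
    (hθ : 0 ≤ θ) (hθτ : θ ≤ τ / 2) :
    proximity (angularQuotient f θ) ⊤ r ≤ log⁺ (2 * (θ * r)) +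
      507936 * (θ * (X * log r ^ 2 / τ ^ 5)) +
      2442 * (X * log r / τ ^ 3) * ((2 * log (80000 * (X * log r / τ ^ 3)) + 6) *
        (invSqrtConst * √θ)) := by
  have hr0 : 0 < r := by linarith
  have hrτ : 0 < r * τ := by positivity
  have hT2 := characteristic_deriv_le_of_growth hf
    (meromorphicOrderAt_ne_top_of_not_isConstantMero hf hc) hr hL hX hcX hτ0 hτ hT
  have hn := zerosPolesCount_deriv_le_of_growth hf hr hL hX hcX' hτ0 hτ hT2
  have hT1 : characteristic (deriv f) ⊤ (r * (1 + τ)) ≤ 610 * (X * log r / τ ^ 2) :=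
    (characteristic_monotoneOn hf.deriv (Set.mem_Ioi.2 (by positivity))
      (Set.mem_Ioi.2 (by positivity)) (by nlinarith)).trans hT2
  have hmain := proximity_angularQuotient_le hf hfNF (meromorphicOrderAt_deriv_ne_top hf hc)
    (r := r) (ρ := r * (1 + τ / 2)) (R := r * (1 + τ)) (θ := θ) (by linarith) (by nlinarith) hθ
    (by nlinarith)
  set L := log r
  set n := zerosPolesCount (deriv f) (r * (1 + τ))
  have hn0 : 0 ≤ n := zerosPolesCount_nonneg _ _
  have hlog : log (2 * (r * (1 + τ))) ≤ 3 * L := by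
    rw [show 3 * L = log (r ^ 3) by rw [log_pow]; norm_num; rfl]
    apply log_le_log (by positivity)
    nlinarith [mul_nonneg hr0.le (sub_nonneg.2 hr),
      mul_nonneg (mul_nonneg hr0.le hr0.le) (sub_nonneg.2 hr)]
  have hlog0 : 0 ≤ log (2 * (r * (1 + τ))) := log_nonneg (by nlinarith)
  set W := X * L / τ ^ 3 with hW
  have hW1 : 1 ≤ W := by
    rw [hW, one_le_div (by positivity)]
    have : τ ^ 3 ≤ 1 := pow_le_one₀ hτ0.le (by linarith)
    nlinarith
  have hM : 2 * characteristic (deriv f) ⊤ (r * (1 + τ)) + fmtConst (deriv f) +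
      n * (2 * log (2 * (r * (1 + τ)))) ≤ 15873 * (X * L ^ 2 / τ ^ 3) := by
    have h1 : n * (2 * log (2 * (r * (1 + τ)))) ≤ 2442 * (X * L / τ ^ 3) * (2 * (3 * L)) := by
      gcongr
    have h2 : X * L / τ ^ 2 ≤ X * L ^ 2 / τ ^ 3 := by
      rw [div_le_div_iff₀ (by positivity) (by positivity)]
      have : τ ≤ L := by linarith
      calc X * L * τ ^ 3 = X * L * τ ^ 2 * τ := by ring
        _ ≤ X * L * τ ^ 2 * L := by gcongr
        _ = _ := by ring
    have h3 : X ≤ X * L ^ 2 / τ ^ 3 := by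
      rw [le_div_iff₀ (by positivity)]
      have : τ ^ 3 ≤ 1 := pow_le_one₀ hτ0.le (by linarith)
      have : τ ^ 3 ≤ L ^ 2 := by nlinarith
      gcongr
    have h4 : 2442 * (X * L / τ ^ 3) * (2 * (3 * L)) = 14652 * (X * L ^ 2 / τ ^ 3) := by ring
    linarith
  have hΛ : 4 * (r * (1 + τ)) * (θ * r) / (r * (1 + τ) - r * (1 + τ / 2)) ^ 2 *
      (2 * characteristic (deriv f) ⊤ (r * (1 + τ)) + fmtConst (deriv f) +
      n * (2 * log (2 * (r * (1 + τ))))) ≤ 507936 * (θ * (X * L ^ 2 / τ ^ 5)) := by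
    have h1 : 4 * (r * (1 + τ)) * (θ * r) / (r * (1 + τ) - r * (1 + τ / 2)) ^ 2
        ≤ 32 * θ / τ ^ 2 := by
      rw [show r * (1 + τ) - r * (1 + τ / 2) = r * τ / 2 by ring,
        div_le_div_iff₀ (by positivity) (by positivity)]
      have : (1 + τ) * (r ^ 2 * θ * τ ^ 2) ≤ 2 * (r ^ 2 * θ * τ ^ 2) := by
        gcongr
        linarith
      nlinarith
    calc _ ≤ 4 * (r * (1 + τ)) * (θ * r) / (r * (1 + τ) - r * (1 + τ / 2)) ^ 2 *
          (15873 * (X * L ^ 2 / τ ^ 3)) := by gcongr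
      _ ≤ 32 * θ / τ ^ 2 * (15873 * (X * L ^ 2 / τ ^ 3)) := by gcongr
      _ = _ := by field_simp; ring
  -- The cardinality is at most 2442 W, and 16(2 · 2442 W + 1) ≤ 80000 W because W ≥ 1.
  have htent : log (tentConst (zerosPoles (deriv f) (r * (1 + τ))).card) ≤ log (80000 * W) := by
    apply log_le_log (by linarith [one_le_tentConst (zerosPoles (deriv f) (r * (1 + τ))).card])
    rw [tentConst]
    have := card_zerosPoles_le (deriv f) (r * (1 + τ))
    change _ ≤ n at this
    linarith
  have hthird : n * ((2 * log (tentConst (zerosPoles (deriv f) (r * (1 + τ))).card) + 6) *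
      (invSqrtConst * √θ)) ≤ 2442 * W * ((2 * log (80000 * W) + 6) * (invSqrtConst * √θ)) := by
    have h0 := log_nonneg (one_le_tentConst (zerosPoles (deriv f) (r * (1 + τ))).card)
    have h1 := invSqrtConst_nonneg
    gcongr
  linarith

end ErrorTerm

/-! ### Choice of parameters and the two cases. -/

section Main

open Real Metric MeromorphicOn

/-- With P = X^δ and τ = 1/(4P), the Poisson term loses P⁵ and the singular term P³ · P, the last
factor from the logarithm. The hypothesis gives √θ ≤ P^{-5} r^{-b/2}, which offsets either loss. -/
theorem exists_proximity_angularQuotient_le {f : ℂ → ℂ} (hf : Meromorphic f)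
    (hfNF : ∀ z, MeromorphicNFAt f z) (hc : ¬ IsConstantMero f) {δ : ℝ} (hδ : 0 < δ) :
    ∃ A : ℝ, ∀ {r X θ b : ℝ}, 2 ≤ r → 1 ≤ log r → 1 ≤ X → fmtConst f ≤ X →
      fmtConst (deriv f) ≤ X → characteristic f ⊤ (r * (1 + X ^ (-δ))) ≤ 2 * X → 0 ≤ θ →
      θ ≤ X ^ (-δ) / 8 → θ ≤ 1 / X ^ (10 * δ) * (1 / r ^ b) → 0 ≤ b →
      proximity (angularQuotient f θ) ⊤ r ≤
        log⁺ (2 * (θ * r)) + A * X * (log r ^ 2 / r ^ (b / 2)) := by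
  -- 5120000 = 80000 · 4³. The term 2/δ comes from log X ≤ X^δ/δ, and 14 = 2(1 + 3) + 6 collects log
  -- L, 3 log P and the additive 6.
  set B := 2 * log 5120000 + 2 / δ + 14
  refine ⟨507936 * 1024 + 2442 * 64 * B * invSqrtConst, ?_⟩
  intro r X θ b hr hL hX hcX hcX' hT hθ hθ8 hθb hb
  have hr0 : 0 < r := by linarith
  have hX0 : 0 < X := by linarith
  set P := X ^ δ with hP
  have hP1 : 1 ≤ P := one_le_rpow hX hδ.le
  have hP0 : 0 < P := by linarith
  have hPinv : X ^ (-δ) = P⁻¹ := rpow_neg hX0.le δ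
  have hP10 : X ^ (10 * δ) = P ^ 10 := by
    rw [hP, ← rpow_natCast, ← rpow_mul hX0.le]
    congr 1
    push_cast
    ring
  rw [hPinv] at hT hθ8
  rw [hP10] at hθb
  have hτ4 : 4 * (1 / (4 * P)) = P⁻¹ := by field_simp
  have hmain := proximity_angularQuotient_le_of_growth hf hfNF hc (τ := 1 / (4 * P)) hr hL hX hcX
    hcX' (by positivity) (one_div_le_one_div_of_le (by norm_num) (by linarith))
    (by rwa [hτ4]) hθ (hθ8.trans_eq (by field_simp; norm_num))
  set L := log r
  set s := √θ with hs
  set v := r ^ (b / 2) with hv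
  have hv1 : 1 ≤ v := one_le_rpow (by linarith) (by linarith)
  have hv0 : 0 < v := by linarith
  have hs0 : 0 ≤ s := sqrt_nonneg θ
  have hvv : r ^ b = v ^ 2 := by
    rw [hv, ← rpow_natCast, ← rpow_mul hr0.le]
    congr 1
    push_cast
    ring
  have hsle : s ≤ 1 / P ^ 5 * (1 / v) := by
    refine sqrt_le_iff.2 ⟨by positivity, hθb.trans_eq ?_⟩
    rw [hvv]
    field_simp
  have hPs : P ^ 5 * s ≤ 1 / v := by
    calc P ^ 5 * s ≤ P ^ 5 * (1 / P ^ 5 * (1 / v)) := by gcongr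
      _ = 1 / v := by field_simp
  have hs1 : s ≤ 1 := by
    have h1 : s ≤ P ^ 5 * s := le_mul_of_one_le_left hs0 (one_le_pow₀ hP1)
    exact h1.trans (hPs.trans ((div_le_one hv0).2 hv1))
  have hθs : θ ≤ s := by
    rw [← mul_self_sqrt hθ]
    exact mul_le_of_le_one_left hs0 hs1
  have hB0 : 0 ≤ B := by
    have := log_nonneg (show (1 : ℝ) ≤ 5120000 by norm_num)
    positivity
  have hL0 : 0 < L := by linarith
  have hPL : 1 ≤ P * L := by nlinarith
  have hlog : 2 * log (80000 * (X * L / (1 / (4 * P)) ^ 3)) + 6 ≤ B * (P * L) := by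
    have e : 80000 * (X * L / (1 / (4 * P)) ^ 3) = 5120000 * (X * (L * P ^ 3)) := by
      field_simp
      ring
    rw [e, log_mul (by norm_num) (by positivity), log_mul hX0.ne' (by positivity),
      log_mul hL0.ne' (by positivity), log_pow]
    have h1 : log X ≤ P / δ := log_le_rpow_div hX0.le hδ
    have h2 : log L ≤ L := log_le_self hL0.le
    have h3 : log P ≤ P := log_le_self hP0.le
    have h4 : P ≤ P * L := le_mul_of_one_le_right hP0.le hL
    have h5 : L ≤ P * L := le_mul_of_one_le_left hL0.le hP1
    have h6 : P / δ ≤ P * L / δ := by gcongr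
    have h7 : log 5120000 ≤ log 5120000 * (P * L) :=
      le_mul_of_one_le_right (log_nonneg (by norm_num)) hPL
    have e2 : B * (P * L) = 2 * (log 5120000 * (P * L)) + 2 * (P * L / δ) + 14 * (P * L) := by
      simp only [B]
      ring
    rw [e2]
    push_cast
    linarith
  have t1 : 507936 * (θ * (X * L ^ 2 / (1 / (4 * P)) ^ 5)) ≤
      507936 * 1024 * X * (L ^ 2 / v) := by
    calc _ ≤ 507936 * (s * (X * L ^ 2 / (1 / (4 * P)) ^ 5)) := by gcongr
      _ = 507936 * 1024 * X * L ^ 2 * (P ^ 5 * s) := by field_simp; ring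
      _ ≤ 507936 * 1024 * X * L ^ 2 * (1 / v) := by gcongr
      _ = _ := by ring
  have hκ := invSqrtConst_nonneg
  have t2 : 2442 * (X * L / (1 / (4 * P)) ^ 3) *
      ((2 * log (80000 * (X * L / (1 / (4 * P)) ^ 3)) + 6) * (invSqrtConst * s)) ≤
      2442 * 64 * B * invSqrtConst * X * (L ^ 2 / v) := by
    calc _ ≤ 2442 * (X * L / (1 / (4 * P)) ^ 3) * (B * (P * L) * (invSqrtConst * s)) := by gcongr
      _ = 2442 * 64 * B * invSqrtConst * X * L ^ 2 * (P ^ 4 * s) := by field_simp; ring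
      _ ≤ 2442 * 64 * B * invSqrtConst * X * L ^ 2 * (P ^ 5 * s) := by
        gcongr
        norm_num
      _ ≤ 2442 * 64 * B * invSqrtConst * X * L ^ 2 * (1 / v) := by gcongr
      _ = _ := by ring
  calc _ ≤ _ := hmain
    _ ≤ log⁺ (2 * (θ * r)) + 507936 * 1024 * X * (L ^ 2 / v) +
      2442 * 64 * B * invSqrtConst * X * (L ^ 2 / v) := by gcongr
    _ = _ := by ring

theorem tendsto_characteristic_atTop {f : ℂ → ℂ} (hf : Meromorphic f) (hc : ¬ IsConstantMero f) :
    Tendsto (characteristic f ⊤) atTop atTop := by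
  refine tendsto_atTop_mono' atTop ?_
    (tendsto_log_atTop.const_mul_atTop (by norm_num : (0 : ℝ) < 1 / 3))
  filter_upwards [eventually_log_le_characteristic hf hc] with r hr
  linarith

theorem shiftBound_le {f : ℂ → ℂ} (hf : Meromorphic f) {ε r : ℝ} (hε : 0 < ε) (hr : 0 < r)
    (hT : 1 ≤ characteristic f ⊤ r) :
    shiftBound f ε r ≤ 1 / characteristic f ⊤ r ^ (3 * ε / (1 + 2 * ε)) *
      (1 / r ^ (ε / (1 + ε))) := by
  rw [shiftBound]
  have h1 : characteristic f ⊤ r ≤ characteristic f ⊤ (r + ε) :=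
    characteristic_monotoneOn hf (Set.mem_Ioi.2 hr) (Set.mem_Ioi.2 (by linarith)) (by linarith)
  gcongr

/-- A single ε handles everything except log⁺(2ωr), which is isolated as the hypothesis `hlog`. -/
theorem isSmallError_of_normalForm {f : ℂ → ℂ} (hf : Meromorphic f)
    (hfNF : ∀ z, MeromorphicNFAt f z) (hc : ¬ IsConstantMero f) {ω : ℝ → ℝ}
    (hω : ∀ r : ℝ, 0 < r → 0 < ω r) {ε : ℝ} (hε : 0 < ε)
    (hωε : ∀ᶠ r in atTop, ω r ≤ shiftBound f ε r)
    (hlog : ∀ η > 0, ∀ᶠ r in atTop, log⁺ (2 * (ω r * r)) ≤ η * characteristic f ⊤ r) :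
    IsSmallError (fun r ↦ proximity (angularQuotient f (ω r)) ⊤ r) f := by
  set a := 3 * ε / (1 + 2 * ε)
  set b := ε / (1 + ε)
  have ha : 0 < a := by positivity
  have hb : 0 < b := by positivity
  set δ := a / 10 with hδa
  have hδ : 0 < δ := by positivity
  have htop := tendsto_characteristic_atTop hf hc
  obtain ⟨E, hE, hgrow⟩ := exists_finiteLogMeasure_growth (characteristic_monotoneOn hf) htop hδ
  obtain ⟨A, hA⟩ := exists_proximity_angularQuotient_le hf hfNF hc hδ
  refine ⟨E, hE, Asymptotics.isLittleO_iff.2 fun η hη ↦ ?_⟩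
  have hdecay : Tendsto (fun r : ℝ ↦ A * (log r ^ 2 / r ^ (b / 2))) atTop (𝓝 (A * 0)) := by
    have := (isLittleO_log_rpow_rpow_atTop 2 (half_pos hb)).tendsto_div_nhds_zero
    refine (this.congr fun r ↦ ?_).const_mul A
    norm_cast
  rw [mul_zero] at hdecay
  rw [eventually_inf_principal] at hgrow ⊢
  filter_upwards [hgrow, hωε, hlog (η / 2) (half_pos hη), eventually_ge_atTop 2,
    tendsto_log_atTop.eventually_ge_atTop 1, htop.eventually_ge_atTop 1,
    htop.eventually_ge_atTop (fmtConst f), htop.eventually_ge_atTop (fmtConst (deriv f)),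
    hdecay.eventually (gt_mem_nhds (half_pos hη)),
    (tendsto_rpow_atTop hb).eventually_ge_atTop 8] with r hT hωr hlogr hr hL hX hcX hcX' hdec hr8 hrE
  have hr0 : 0 < r := by linarith
  set X := characteristic f ⊤ r
  have hX0 : 0 < X := by linarith
  have hω0 := (hω r hr0).le
  have hωb : ω r ≤ 1 / X ^ a * (1 / r ^ b) := hωr.trans (shiftBound_le hf hε hr0 hX)
  have hω8 : ω r ≤ X ^ (-δ) / 8 := by
    refine hωb.trans ?_
    rw [rpow_neg hX0.le, ← one_div, div_eq_mul_one_div _ (8 : ℝ)]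
    have : X ^ δ ≤ X ^ a := rpow_le_rpow_of_exponent_le hX (by rw [hδa]; linarith)
    gcongr
  have hmain := hA hr hL hX hcX hcX' (hT hrE) hω0 hω8
    (by rwa [hδa, mul_div_cancel₀ a (by norm_num)]) hb.le
  rw [norm_of_nonneg (proximity_nonneg r), norm_of_nonneg hX0.le]
  have h2 : A * X * (log r ^ 2 / r ^ (b / 2)) ≤ η / 2 * X := by
    calc _ = A * (log r ^ 2 / r ^ (b / 2)) * X := by ring
      _ ≤ _ := by gcongr
  linarith

theorem eventually_posLog_le_of_forall {f : ℂ → ℂ} (hf : Meromorphic f) (hc : ¬ IsConstantMero f)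
    {ω : ℝ → ℝ} (hω : ∀ r : ℝ, 0 < r → 0 < ω r)
    (h : ∀ ε : ℝ, 0 < ε → ∀ᶠ r in atTop, ω r ≤ shiftBound f ε r) {η : ℝ} (hη : 0 < η) :
    ∀ᶠ r in atTop, log⁺ (2 * (ω r * r)) ≤ η * characteristic f ⊤ r := by
  have htop := tendsto_characteristic_atTop hf hc
  -- With ε = 6/η, log(ωr) ≤ (log r)/(1 + ε) ≤ (η/6) · 3T, half of the allowance; the other half
  -- absorbs log 2.
  have hε : 0 < 6 / η := by positivity
  filter_upwards [h (6 / η) hε, eventually_ge_atTop 1, htop.eventually_ge_atTop 1,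
    htop.eventually_ge_atTop (2 / η), eventually_log_le_characteristic hf hc]
    with r h1 hr hX hX2 hlog
  have hr0 : 0 < r := by linarith
  set X := characteristic f ⊤ r
  have hXpow : 1 ≤ X ^ (3 * (6 / η) / (1 + 2 * (6 / η))) := one_le_rpow hX (by positivity)
  have h2 : ω r ≤ 1 / r ^ (6 / η / (1 + 6 / η)) := by
    refine h1.trans ((shiftBound_le hf hε hr0 hX).trans ?_)
    refine mul_le_of_le_one_left (by positivity) ((div_le_one (by positivity)).2 hXpow)
  have h3 : ω r * r ≤ r ^ (1 / (1 + 6 / η)) := by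
    calc ω r * r ≤ 1 / r ^ (6 / η / (1 + 6 / η)) * r := by gcongr
      _ = r ^ (1 - 6 / η / (1 + 6 / η)) := by rw [rpow_sub hr0, rpow_one]; ring
      _ = _ := by
        congr 1
        field_simp
        ring
  have hpos : 0 < ω r * r := mul_pos (hω r hr0) hr0
  have hlog0 : 0 ≤ log r := log_nonneg hr
  have hlog2 : 0 ≤ log 2 := log_nonneg one_le_two
  have h4 : log (2 * (ω r * r)) ≤ log 2 + 1 / (1 + 6 / η) * log r := by
    rw [log_mul two_ne_zero hpos.ne', ← log_rpow hr0]
    gcongr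
  have h5 : 1 / (1 + 6 / η) * log r ≤ η / 6 * (3 * X) := by
    have : 1 / (1 + 6 / η) ≤ η / 6 := by
      rw [div_le_iff₀ (by positivity)]
      have : η / 6 * (1 + 6 / η) = η / 6 + 1 := by field_simp
      linarith
    gcongr
  have h6 : 1 ≤ η / 2 * X := by
    rw [div_le_iff₀ hη] at hX2
    linarith
  rw [posLog_apply]
  refine max_le (by positivity) ?_
  linarith [log_two_lt_d9]

theorem eventually_posLog_le_of_not_isRationalMero {f : ℂ → ℂ} (hf : Meromorphic f)
    (hc : ¬ IsConstantMero f) (hr : ¬ IsRationalMero f) {ω : ℝ → ℝ}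
    (hω : ∀ r : ℝ, 0 < r → 0 < ω r) {ε : ℝ} (hε : 0 < ε)
    (h : ∀ᶠ r in atTop, ω r ≤ shiftBound f ε r) {η : ℝ} (hη : 0 < η) :
    ∀ᶠ r in atTop, log⁺ (2 * (ω r * r)) ≤ η * characteristic f ⊤ r := by
  have htop := tendsto_characteristic_atTop hf hc
  filter_upwards [h, eventually_ge_atTop 1, htop.eventually_ge_atTop 1,
    htop.eventually_ge_atTop (2 / η),
    Asymptotics.isLittleO_iff.1 (isLittleO_log_characteristic hf hc hr) (half_pos hη)]
    with r h1 hr hX hX2 hlog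
  have hr0 : 0 < r := by linarith
  set X := characteristic f ⊤ r
  have hlog0 : 0 ≤ log r := log_nonneg hr
  rw [norm_of_nonneg hlog0, norm_of_nonneg (by linarith)] at hlog
  have hXpow : 1 ≤ X ^ (3 * ε / (1 + 2 * ε)) := one_le_rpow hX (by positivity)
  have hrpow : 1 ≤ r ^ (ε / (1 + ε)) := one_le_rpow hr (by positivity)
  have h2 : ω r ≤ 1 := by
    refine h1.trans ((shiftBound_le hf hε hr0 hX).trans ?_)
    exact mul_le_one₀ ((div_le_one (by positivity)).2 hXpow) (by positivity)
      ((div_le_one (by positivity)).2 hrpow)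
  have hpos : 0 < ω r * r := mul_pos (hω r hr0) hr0
  have h4 : log (2 * (ω r * r)) ≤ log 2 + log r := by
    rw [log_mul two_ne_zero hpos.ne']
    gcongr
    exact mul_le_of_le_one_left hr0.le h2
  have h6 : 1 ≤ η / 2 * X := by
    rw [div_le_iff₀ hη] at hX2
    linarith
  rw [posLog_apply]
  refine max_le (by positivity) ?_
  linarith [log_two_lt_d9]

theorem angularQuotient_eventuallyEq {f g : ℂ → ℂ} (h : f =ᶠ[codiscrete ℂ] g) (θ : ℝ) :
    angularQuotient f θ =ᶠ[codiscrete ℂ] angularQuotient g θ := by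
  refine eventuallyEq_codiscrete_of_forall_nhdsNE fun x ↦ ?_
  have hx := nhdsNE_of_eventuallyEq_codiscrete h
  set e := Complex.exp (Complex.I * θ) with he
  have he0 : e ≠ 0 := Complex.exp_ne_zero _
  have ht : Tendsto (fun z ↦ e * z) (𝓝[≠] x) (𝓝[≠] (e * x)) := by
    refine tendsto_nhdsWithin_of_tendsto_nhds_of_eventually_within _ ?_ ?_
    · exact (continuous_const_mul e).continuousAt.tendsto.mono_left nhdsWithin_le_nhds
    · filter_upwards [self_mem_nhdsWithin] with z hz
      exact fun hh ↦ hz (mul_left_cancel₀ he0 hh)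
  filter_upwards [hx x, (hx x).nhdsNE_deriv, ht.eventually (hx (e * x))] with z h1 h2 h3
  simp only [angularQuotient, ← he]
  rw [h1, h2, h3]

end Main

theorem theorem1p3 (f : ℂ → ℂ) (hf : Meromorphic f) (hconst : ¬ IsConstantMero f)
    (ω : ℝ → ℝ) (hω : ∀ r : ℝ, 0 < r → 0 < ω r) :
    ((∀ ε : ℝ, 0 < ε → ∀ᶠ r in atTop, ω r ≤ shiftBound f ε r) →
      IsSmallError (fun r => proximity (angularQuotient f (ω r)) ⊤ r) f) ∧
    (¬ IsRationalMero f → (∃ ε : ℝ, 0 < ε ∧ ∀ᶠ r in atTop, ω r ≤ shiftBound f ε r) →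
      IsSmallError (fun r => proximity (angularQuotient f (ω r)) ⊤ r) f) := by
  -- The values of f on a discrete set are arbitrary, so f is replaced by its normal form; for r > 0
  -- neither the characteristic nor the proximity functions change.
  set g := toMeromorphicNFOn f Set.univ
  have hfg : f =ᶠ[codiscrete ℂ] g := toMeromorphicNFOn_eqOn_codiscrete hf.meromorphicOn
  have hgNF (z : ℂ) : MeromorphicNFAt g z :=
    meromorphicNFOn_toMeromorphicNFOn f Set.univ (Set.mem_univ z)
  have hg : Meromorphic g := fun z ↦ (hgNF z).meromorphicAt
  have hgc : ¬ IsConstantMero g := fun ⟨c, h⟩ ↦ hconst ⟨c, hfg.trans h⟩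
  have hT {r : ℝ} (hr : 0 < r) : characteristic g ⊤ r = characteristic f ⊤ r :=
    (characteristic_congr_codiscrete hfg hr.ne').symm
  have hshift {ε : ℝ} (hε : 0 < ε) (h : ∀ᶠ r in atTop, ω r ≤ shiftBound f ε r) :
      ∀ᶠ r in atTop, ω r ≤ shiftBound g ε r := by
    filter_upwards [h, eventually_gt_atTop 0] with r hr hr0
    rwa [shiftBound, hT (add_pos hr0 hε)]
  have hback (h : IsSmallError (fun r => proximity (angularQuotient g (ω r)) ⊤ r) g) :
      IsSmallError (fun r => proximity (angularQuotient f (ω r)) ⊤ r) f := by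
    obtain ⟨E, hE, hlo⟩ := h
    have hpos : ∀ᶠ r : ℝ in atTop ⊓ 𝓟 Eᶜ, 0 < r :=
      (eventually_gt_atTop 0).filter_mono inf_le_left
    refine ⟨E, hE, hlo.congr' ?_ ?_⟩
    · filter_upwards [hpos] with r hr
      exact (proximity_congr_codiscrete (angularQuotient_eventuallyEq hfg (ω r)) hr.ne').symm
    · filter_upwards [hpos] with r hr using hT hr
  constructor
  · intro h
    have h' (ε : ℝ) (hε : 0 < ε) := hshift hε (h ε hε)
    -- ε = 1 is an arbitrary choice; the full family of conditions enters only through the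
    -- logarithmic term.
    exact hback (isSmallError_of_normalForm hg hgNF hgc hω one_pos (h' 1 one_pos) fun η hη ↦
      eventually_posLog_le_of_forall hg hgc hω h' hη)
  · rintro hrat ⟨ε, hε, h⟩
    have hgr : ¬ IsRationalMero g := fun ⟨p, q, hq, h⟩ ↦ hrat ⟨p, q, hq, hfg.trans h⟩
    exact hback (isSmallError_of_normalForm hg hgNF hgc hω hε (hshift hε h) fun η hη ↦
      eventually_posLog_le_of_not_isRationalMero hg hgc hgr hω hε (hshift hε h) hη)
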